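/- All Hilbert spaces are finite-dimensional and nonzero, logarithms are in base $2$, and a state is a positive semidefinite operator of trace $1$. A channel is a completely positive trace-preserving linear map. For $\operatorname{supp}\rho\subseteq\operatorname{supp}\sigma$ let $D(\rho\|\sigma)=\operatorname{tr}[\rho(\log\rho-\log\sigma)]$, and let $I(A{:}B)_\rho=D(\rho_{AB}\|\rho_A\otimes\rho_B)$, where $\rho_A,\rho_B$ are the marginals of $\rho_{AB}$. Let $\mathcal N_{A\to B}$ be a channel and $\rho_{E_AE_B}$ a bipartite state. Define - $\chi(\mathcal N)=\sup I(X{:}B)_\sigma$ over all $\sigma_{XB}=\sum_x p(x)|x\rangle\langle x|_X\otimes\mathcal N(\rho_A^x)$, where $p$ is a probability distribution on a finite alphabet and the $\rho_A^x$ are states on $A$; - $\chi_\rho(\mathcal N)=\sup I(X{:}BE_B)_\omega$ and $I_\rho(\mathcal N)=\sup I(XE_B{:}B)_\omega$, both over all $\omega_{XBE_B}=\sum_x p(x)|x\rangle\langle x|_X\otimes\big((\mathcal N\circ\mathcal E^x)\otimes\mathrm{id}_{E_B}\big)(\rho_{E_AE_B})$, where $p$ is a probability distribution on a finite alphabet and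 the $\mathcal E^x$ are channels from $E_A$ to $A$; - for a bipartite state $\tau_{E_AE_B}$, the relative entropy of discord $D_R(\tau)=\inf_{\{\phi_y\}}D\big(\tau\,\big\|\sum_y\langle\phi_y|\tau|\phi_y\rangle\otimes|\phi_y\rangle\langle\phi_y|\big)$ over all orthonormal bases $\{\phi_y\}$ of $E_B$, where $\langle\phi_y|\tau|\phi_y\rangle$ is an operator on $E_A$; - the discord of formation $D_F(\rho)=\inf\sum_x p(x)D_R(\rho^x)$ over all finite decompositions $\rho=\sum_x p(x)\rho^x$, where $p$ is a probability distribution and the $\rho^x$ are states on $E_AE_B$. Then all these suprema and infima are finite (and over nonempty sets), and $$\chi_\rho(\mathcal N)-\chi(\mathcal N)\;\le\; I_\rho(\mathcal N)-\chi(\mathcal N)\;\le\; D_F(\rho_{E_AE_B}).$$ -/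

import Mathlib

open scoped Kronecker ComplexOrder

namespace QInfo

noncomputable section

/-- A density operator on `ℂ^ι`. A bipartite system `AB` is indexed by `α × β`. -/
def IsState {ι : Type*} [Fintype ι] (ρ : Matrix ι ι ℂ) : Prop :=
  ρ.PosSemidef ∧ ρ.trace = 1

/-- The partial trace over the second system, `M_A = tr_B M_{AB}`. -/
def trSnd {α β : Type*} [Fintype β] (M : Matrix (α × β) (α × β) ℂ) : Matrix α α ℂ :=
  Matrix.of fun a a' => ∑ b, M (a, b) (a', b)

/-- The partial trace over the first system, `M_B = tr_A M_{AB}`. -/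
def trFst {α β : Type*} [Fintype α] (M : Matrix (α × β) (α × β) ℂ) : Matrix β β ℂ :=
  Matrix.of fun b b' => ∑ a, M (a, b) (a, b')

/-- The map `Φ ⊗ id_R`, applied to an operator on `A ⊗ R`. -/
def applyFst {α β r : Type*} (Φ : Matrix α α ℂ →ₗ[ℂ] Matrix β β ℂ)
    (M : Matrix (α × r) (α × r) ℂ) : Matrix (β × r) (β × r) ℂ :=
  Matrix.of fun i j => Φ (Matrix.of fun a a' => M (a, i.2) (a', j.2)) i.1 j.1

/-- Quantum channels: completely positive and trace-preserving linear maps. -/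
structure IsChannel {α β : Type*} [Fintype α] [Fintype β]
    (Φ : Matrix α α ℂ →ₗ[ℂ] Matrix β β ℂ) : Prop where
  completelyPositive : ∀ (k : ℕ) (M : Matrix (α × Fin k) (α × Fin k) ℂ),
    M.PosSemidef → (applyFst Φ M).PosSemidef
  tracePreserving : ∀ M : Matrix α α ℂ, (Φ M).trace = M.trace

/-- The base-2 logarithm of a positive semidefinite matrix, by functional calculus. It is `0` on
the kernel, which implements the convention `0 log 0 = 0`. -/
def log2 {ι : Type*} [Fintype ι] [DecidableEq ι] (ρ : Matrix ι ι ℂ) : Matrix ι ι ℂ :=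
  cfc (Real.logb 2) ρ

/-- The quantum relative entropy `D(ρ‖σ) = tr ρ (log ρ - log σ)`. It is only used below for pairs in
which the support of `ρ` is contained in the support of `σ`. -/
def relEntropy {ι : Type*} [Fintype ι] [DecidableEq ι] (ρ σ : Matrix ι ι ℂ) : ℝ :=
  (ρ * (log2 ρ - log2 σ)).trace.re

/-- The quantum mutual information `I(A:B)_ρ = D(ρ_{AB} ‖ ρ_A ⊗ ρ_B)`. -/
def mutualInfo {α β : Type*} [Fintype α] [Fintype β] [DecidableEq α] [DecidableEq β]
    (ρ : Matrix (α × β) (α × β) ℂ) : ℝ :=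
  relEntropy ρ (trSnd ρ ⊗ₖ trFst ρ)

/-- The classical-quantum state `∑ₓ p(x) |x⟩⟨x|_X ⊗ ω^x`, with alphabet `X = {0, …, n - 1}`. -/
def cqState {ι : Type*} {n : ℕ} (p : Fin n → ℝ) (ω : Fin n → Matrix ι ι ℂ) :
    Matrix (Fin n × ι) (Fin n × ι) ℂ :=
  ∑ x, (p x : ℂ) • (Matrix.single x x (1 : ℂ) ⊗ₖ ω x)

/-- Regroups an operator on `X ⊗ (B ⊗ E)` as an operator on `(X ⊗ E) ⊗ B`. -/
def regroup {ξ β ε : Type*} (M : Matrix (ξ × (β × ε)) (ξ × (β × ε)) ℂ) :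
    Matrix ((ξ × ε) × β) ((ξ × ε) × β) ℂ :=
  Matrix.of fun i j => M (i.1.1, (i.2, i.1.2)) (j.1.1, (j.2, j.1.2))

section Informations

variable {α β εA εB : Type*} [Fintype α] [Fintype β] [Fintype εA] [Fintype εB]
  [DecidableEq β] [DecidableEq εB]

/-- The values `I(X:B)` over which the Holevo information of a channel is the maximum: `p` is a
probability distribution on a finite alphabet and the `σ x` are input states. -/
def holevoValues (N : Matrix α α ℂ →ₗ[ℂ] Matrix β β ℂ) : Set ℝ :=
  {v | ∃ (n : ℕ) (p : Fin n → ℝ) (σ : Fin n → Matrix α α ℂ),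
    p ∈ stdSimplex ℝ (Fin n) ∧ (∀ x, IsState (σ x)) ∧
    v = mutualInfo (cqState p fun x => N (σ x))}

/-- The Holevo information `χ(N)`. -/
def holevoInfo (N : Matrix α α ℂ →ₗ[ℂ] Matrix β β ℂ) : ℝ :=
  sSup (holevoValues N)

/-- The state `ω_{XBE_B} = ∑ₓ p(x) |x⟩⟨x|_X ⊗ (N ∘ 𝓔^x)(ρ_{E_A E_B})`. -/
def assistedState (ρ : Matrix (εA × εB) (εA × εB) ℂ) (N : Matrix α α ℂ →ₗ[ℂ] Matrix β β ℂ)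
    {n : ℕ} (p : Fin n → ℝ) (E : Fin n → (Matrix εA εA ℂ →ₗ[ℂ] Matrix α α ℂ)) :
    Matrix (Fin n × (β × εB)) (Fin n × (β × εB)) ℂ :=
  cqState p fun x => applyFst (N ∘ₗ E x) ρ

/-- The values `I(X:BE_B)_ω` over all probability distributions and encoding channels. -/
def assistedHolevoValues (ρ : Matrix (εA × εB) (εA × εB) ℂ)
    (N : Matrix α α ℂ →ₗ[ℂ] Matrix β β ℂ) : Set ℝ :=
  {v | ∃ (n : ℕ) (p : Fin n → ℝ) (E : Fin n → (Matrix εA εA ℂ →ₗ[ℂ] Matrix α α ℂ)),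
    p ∈ stdSimplex ℝ (Fin n) ∧ (∀ x, IsChannel (E x)) ∧
    v = mutualInfo (assistedState ρ N p E)}

/-- The `ρ`-assisted Holevo information `χ_ρ(N)`. -/
def assistedHolevoInfo (ρ : Matrix (εA × εB) (εA × εB) ℂ)
    (N : Matrix α α ℂ →ₗ[ℂ] Matrix β β ℂ) : ℝ :=
  sSup (assistedHolevoValues ρ N)

/-- The values `I(XE_B:B)_ω` over all probability distributions and encoding channels. -/
def assistedMutualValues (ρ : Matrix (εA × εB) (εA × εB) ℂ)
    (N : Matrix α α ℂ →ₗ[ℂ] Matrix β β ℂ) : Set ℝ :=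
  {v | ∃ (n : ℕ) (p : Fin n → ℝ) (E : Fin n → (Matrix εA εA ℂ →ₗ[ℂ] Matrix α α ℂ)),
    p ∈ stdSimplex ℝ (Fin n) ∧ (∀ x, IsChannel (E x)) ∧
    v = mutualInfo (regroup (assistedState ρ N p E))}

/-- The `ρ`-assisted mutual information `I_ρ(N)`. -/
def assistedMutualInfo (ρ : Matrix (εA × εB) (εA × εB) ℂ)
    (N : Matrix α α ℂ →ₗ[ℂ] Matrix β β ℂ) : ℝ :=
  sSup (assistedMutualValues ρ N)

end Informations

section Discord

variable {α β : Type*} [Fintype α] [Fintype β] [DecidableEq α] [DecidableEq β]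

/-- The projection `|φ⟩⟨φ|`. -/
def proj (φ : EuclideanSpace ℂ β) : Matrix β β ℂ :=
  Matrix.of fun b b' => φ b * star (φ b')

/-- The operator `⟨φ|_B M_{AB} |φ⟩_B` on `A`. For a state `M` and a unit vector `φ_y` it is the
product `p_y ρ_A^y` of an outcome probability and the conditional state (and `0` if `p_y = 0`). -/
def condOp (M : Matrix (α × β) (α × β) ℂ) (φ : EuclideanSpace ℂ β) : Matrix α α ℂ :=
  Matrix.of fun a a' => ∑ b, ∑ b', star (φ b) * M (a, b) (a', b') * φ b'

/-- The state `∑_y p_y ρ_A^y ⊗ |φ_y⟩⟨φ_y|_B` left by measuring `B` in the basis `φ`. -/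
def measured (ρ : Matrix (α × β) (α × β) ℂ)
    (φ : OrthonormalBasis β ℂ (EuclideanSpace ℂ β)) : Matrix (α × β) (α × β) ℂ :=
  ∑ y, condOp ρ (φ y) ⊗ₖ proj (φ y)

/-- The relative entropies over which the relative entropy of discord is the minimum. -/
def discordValues (ρ : Matrix (α × β) (α × β) ℂ) : Set ℝ :=
  {v | ∃ φ : OrthonormalBasis β ℂ (EuclideanSpace ℂ β), v = relEntropy ρ (measured ρ φ)}

/-- The relative entropy of discord `D_R(ρ_{AB})`. -/
def relEntropyDiscord (ρ : Matrix (α × β) (α × β) ℂ) : ℝ :=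
  sInf (discordValues ρ)

/-- The values `∑ₓ p(x) D_R(ρ^x)` over all finite decompositions `ρ = ∑ₓ p(x) ρ^x` into states. -/
def formationValues (ρ : Matrix (α × β) (α × β) ℂ) : Set ℝ :=
  {v | ∃ (n : ℕ) (p : Fin n → ℝ) (σ : Fin n → Matrix (α × β) (α × β) ℂ),
    p ∈ stdSimplex ℝ (Fin n) ∧ (∀ x, IsState (σ x)) ∧ ρ = ∑ x, (p x : ℂ) • σ x ∧
    v = ∑ x, p x * relEntropyDiscord (σ x)}

/-- The discord of formation `D_F(ρ_{AB})`, the convex roof of `D_R`. -/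
def discordOfFormation (ρ : Matrix (α × β) (α × β) ℂ) : ℝ :=
  sInf (formationValues ρ)

end Discord

end

end QInfo

/-!
Write `D` for the relative entropy and `ω` for the state on `X B E_B` produced by an encoding. The
channels act on `E_A` only, so the reduced state of `ω` on `E_B` is always that of `ρ`.

*First inequality.* For this reason `I(X E_B : B) - I(X : B E_B) = I(B : E_B) ≥ 0` for every
encoding (`mutualInfo_assistedState_le`), by Klein's inequality (`relEntropy_nonneg`).

*Second inequality.* Fix an encoding, with average output `η` on `B`, a decomposition
`ρ = ∑ⱼ qⱼ ρʲ` and a measurement basis `φʲ` of `E_B` for each `j`. By the independence above,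
`I(X E_B : B)` is the average over `x` of `D(ωˣ ‖ η ⊗ ρ_{E_B})`
(`mutualInfo_regroup_cqState`), which joint convexity (`relEntropy_sum_le`) bounds by the average
over `x` and `j` of `D(ωˣʲ ‖ η ⊗ ρʲ_{E_B})`, where `ωˣʲ` is the output for the assisting state `ρʲ`.
Let `E_B` now be measured in the basis `φʲ`. The entropy of `E_B` does not decrease
(`sum_outcome_logb_le`), while the entropy of `B E_B` increases by the relative entropy of `ωˣʲ` to
its measured version, which data processing under the channel `N ∘ 𝓔ˣ` bounds by the relative
entropy of `ρʲ` to its own measured version (`relEntropy_applyFst_le`). What remains after the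
measurement is the Holevo information of the ensemble of inputs to `N` labelled by message, index
`j` and outcome, which is at most `χ(N)` (`mutualInfo_regroup_assistedState_le`). The infimum over
bases and decompositions gives the claim, and any one decomposition shows that the supremum
`I_ρ(N)` is finite.

*Data processing* (`TwoPositive.relEntropy_le`), which also yields joint convexity, rests on the
formula `D(ρ‖σ) log 2 = ∫₀^∞ (⟨ρ, (L_σ + t R_ρ)⁻¹ ρ⟩ - tr ρ / (1 + t)) dt`, with `L_σ` and `R_ρ` the
multiplications by `σ` from the left and by `ρ` from the right. For each `t` the quadratic form in
the integrand is the maximum over `Y` of `2 Re tr Yᴴρ - tr YᴴσY - t tr YρYᴴ`. If `Y` is a maximizer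
for the images `Φ(ρ)`, `Φ(σ)`, then `Z = Φ†(Y)` is a competitor for `ρ`, `σ` that does at least as
well, by the Schwarz inequality for two-positive maps. So the form decreases under `Φ`
(`TwoPositive.resolventForm_le`). In place of the integral, its explicit antiderivative in
eigenbases (`logForm`) is compared at the input and at the output.
-/

namespace QInfo

open Matrix

/-! ### Spectral decompositions and the functional `tr (ρ log σ)` -/

section Spectral

variable {ι κ ι' κ' ξ : Type*} [Fintype ι] [Fintype κ] [DecidableEq ι] [DecidableEq κ]
  [Fintype ι'] [Fintype κ'] [DecidableEq ι'] [DecidableEq κ'] [Fintype ξ] [DecidableEq ξ]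

/-- A spectral decomposition `σ = V diag(s) Vᴴ`. The unitary `V` may have columns indexed by a type
other than that of its rows, so that reindexing a matrix changes `V` only. -/
structure IsSpectral (V : Matrix ι κ ℂ) (s : κ → ℝ) (σ : Matrix ι ι ℂ) : Prop where
  star_mul : Vᴴ * V = 1
  mul_star : V * Vᴴ = 1
  eq : σ = V * diagonal (fun k => (s k : ℂ)) * Vᴴ

theorem exists_isSpectral {σ : Matrix ι ι ℂ} (h : σ.IsHermitian) :
    ∃ (V : Matrix ι ι ℂ) (s : ι → ℝ), IsSpectral V s σ :=
  ⟨h.eigenvectorUnitary, h.eigenvalues,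
    by simpa [star_eq_conjTranspose] using Unitary.coe_star_mul_self h.eigenvectorUnitary,
    by simpa [star_eq_conjTranspose] using Unitary.coe_mul_star_self h.eigenvectorUnitary,
    by simpa [Unitary.conjStarAlgAut_apply, Function.comp_def, star_eq_conjTranspose] using
      h.spectral_theorem⟩

namespace IsSpectral

variable {V : Matrix ι κ ℂ} {s : κ → ℝ} {σ : Matrix ι ι ℂ}

theorem isHermitian (h : IsSpectral V s σ) : σ.IsHermitian := by
  rw [h.eq, IsHermitian]
  simp [conjTranspose_mul, diagonal_conjTranspose, Matrix.mul_assoc, Pi.star_def]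

theorem conj_eq (h : IsSpectral V s σ) : Vᴴ * σ * V = diagonal (fun k => (s k : ℂ)) := by
  rw [h.eq]
  calc _ = (Vᴴ * V) * diagonal (fun k => (s k : ℂ)) * (Vᴴ * V) := by simp only [Matrix.mul_assoc]
    _ = _ := by rw [h.star_mul, Matrix.one_mul, Matrix.mul_one]

theorem eigenvalue_nonneg (h : IsSpectral V s σ) (hσ : σ.PosSemidef) (k : κ) : 0 ≤ s k := by
  have := (hσ.conjTranspose_mul_mul_same V).diag_nonneg (i := k)
  rw [h.conj_eq] at this
  simpa using this

theorem posSemidef (h : IsSpectral V s σ) (hs : ∀ k, 0 ≤ s k) : σ.PosSemidef := by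
  rw [h.eq]
  exact (PosSemidef.diagonal fun k => by simpa using hs k).mul_mul_conjTranspose_same V

theorem sum_eigenvalues (h : IsSpectral V s σ) : ∑ k, s k = σ.trace.re := by
  have h2 : σ.trace = (diagonal (fun k => (s k : ℂ))).trace := by
    rw [← h.conj_eq, Matrix.trace_mul_comm, ← Matrix.mul_assoc, h.mul_star, Matrix.one_mul]
  rw [h2, trace_diagonal]
  simp

/-- The functional calculus may be computed in any spectral decomposition: the two eigenbases are
intertwined by a matrix that only connects equal eigenvalues. -/
theorem cfc (h : IsSpectral V s σ) (f : ℝ → ℝ) :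
    cfc f σ = V * diagonal (fun k => (f (s k) : ℂ)) * Vᴴ := by
  have hH := h.isHermitian
  have hU1 : (hH.eigenvectorUnitary : Matrix ι ι ℂ)ᴴ * hH.eigenvectorUnitary = 1 := by
    simpa [star_eq_conjTranspose] using Unitary.coe_star_mul_self hH.eigenvectorUnitary
  have hU2 :
      (hH.eigenvectorUnitary : Matrix ι ι ℂ) * (hH.eigenvectorUnitary : Matrix ι ι ℂ)ᴴ = 1 := by
    simpa [star_eq_conjTranspose] using Unitary.coe_mul_star_self hH.eigenvectorUnitary
  have hs : σ = hH.eigenvectorUnitary * diagonal (fun i => (hH.eigenvalues i : ℂ)) *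
      (hH.eigenvectorUnitary : Matrix ι ι ℂ)ᴴ := by
    simpa [Unitary.conjStarAlgAut_apply, Function.comp_def, star_eq_conjTranspose] using
      hH.spectral_theorem
  have hf : _root_.cfc f σ =
      hH.eigenvectorUnitary * diagonal (fun i => (f (hH.eigenvalues i) : ℂ)) *
      (hH.eigenvectorUnitary : Matrix ι ι ℂ)ᴴ := by
    rw [hH.cfc_eq, IsHermitian.cfc]
    simp [Unitary.conjStarAlgAut_apply, Function.comp_def, star_eq_conjTranspose]
  generalize (hH.eigenvectorUnitary : Matrix ι ι ℂ) = U at *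
  generalize hH.eigenvalues = e at *
  have h1 : diagonal (fun k => (s k : ℂ)) * (Vᴴ * U) =
      (Vᴴ * U) * diagonal (fun i => (e i : ℂ)) := by
    calc _ = (Vᴴ * V) * diagonal (fun k => (s k : ℂ)) * (Vᴴ * U) := by
          rw [h.star_mul, Matrix.one_mul]
      _ = Vᴴ * σ * U := by rw [h.eq]; simp only [Matrix.mul_assoc]
      _ = Vᴴ * U * diagonal (fun i => (e i : ℂ)) * (Uᴴ * U) := by
          conv_lhs => rw [hs]
          simp only [Matrix.mul_assoc]
      _ = _ := by rw [hU1, Matrix.mul_one]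
  have h2 : diagonal (fun k => (f (s k) : ℂ)) * (Vᴴ * U) =
      (Vᴴ * U) * diagonal (fun i => (f (e i) : ℂ)) := by
    ext k i
    have := congrFun (congrFun h1 k) i
    rw [diagonal_mul, mul_diagonal, mul_comm] at this ⊢
    by_cases hw : (Vᴴ * U) k i = 0
    · simp [hw]
    · have := mul_left_cancel₀ hw this
      rw [Complex.ofReal_inj] at this
      rw [this]
  calc _ = (V * Vᴴ) * U * diagonal (fun i => (f (e i) : ℂ)) * Uᴴ := by
        rw [hf, h.mul_star, Matrix.one_mul]
    _ = V * ((Vᴴ * U) * diagonal (fun i => (f (e i) : ℂ))) * Uᴴ := by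
        simp only [Matrix.mul_assoc]
    _ = V * diagonal (fun k => (f (s k) : ℂ)) * Vᴴ * (U * Uᴴ) := by
        rw [← h2]; simp only [Matrix.mul_assoc]
    _ = _ := by rw [hU2, Matrix.mul_one]

theorem smul (h : IsSpectral V s σ) (c : ℝ) : IsSpectral V (fun k => c * s k) ((c : ℂ) • σ) where
  star_mul := h.star_mul
  mul_star := h.mul_star
  eq := by
    have : diagonal (fun k => ((c * s k : ℝ) : ℂ)) = (c : ℂ) • diagonal (fun k => (s k : ℂ)) := by
      ext i j; by_cases hij : i = j <;> simp [hij]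
    rw [this, h.eq]; simp

theorem conj (h : IsSpectral V s σ) {W : Matrix ι' ι ℂ} (h1 : Wᴴ * W = 1) (h2 : W * Wᴴ = 1) :
    IsSpectral (W * V) s (W * σ * Wᴴ) where
  star_mul := by
    rw [conjTranspose_mul]
    calc _ = Vᴴ * (Wᴴ * W) * V := by simp only [Matrix.mul_assoc]
      _ = _ := by rw [h1, Matrix.mul_one, h.star_mul]
  mul_star := by
    rw [conjTranspose_mul]
    calc _ = W * (V * Vᴴ) * Wᴴ := by simp only [Matrix.mul_assoc]
      _ = _ := by rw [h.mul_star, Matrix.mul_one, h2]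
  eq := by rw [h.eq, conjTranspose_mul]; simp only [Matrix.mul_assoc]

theorem kronecker (h : IsSpectral V s σ) {W : Matrix ι' κ' ℂ} {t : κ' → ℝ} {τ : Matrix ι' ι' ℂ}
    (h' : IsSpectral W t τ) : IsSpectral (V ⊗ₖ W) (fun k => s k.1 * t k.2) (σ ⊗ₖ τ) where
  star_mul := by
    rw [conjTranspose_kronecker, ← mul_kronecker_mul, h.star_mul, h'.star_mul, one_kronecker_one]
  mul_star := by
    rw [conjTranspose_kronecker, ← mul_kronecker_mul, h.mul_star, h'.mul_star, one_kronecker_one]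
  eq := by
    have : diagonal (fun k : κ × κ' => ((s k.1 * t k.2 : ℝ) : ℂ)) =
        diagonal (fun k => (s k : ℂ)) ⊗ₖ diagonal (fun k => (t k : ℂ)) := by
      rw [diagonal_kronecker_diagonal]; simp
    rw [this, conjTranspose_kronecker, ← mul_kronecker_mul, ← mul_kronecker_mul, ← h.eq, ← h'.eq]

end IsSpectral

/-- The functional `tr (ρ log₂ σ)`; minus the entropy of `ρ` when `σ = ρ`. -/
noncomputable def logTrace (ρ σ : Matrix ι ι ℂ) : ℝ := (ρ * log2 σ).trace.re

theorem relEntropy_eq (ρ σ : Matrix ι ι ℂ) :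
    relEntropy ρ σ = logTrace ρ ρ - logTrace ρ σ := by
  simp [relEntropy, logTrace, Matrix.mul_sub]

omit [DecidableEq ξ] in
theorem logTrace_sum_smul (p : ξ → ℝ) (ρ : ξ → Matrix ι ι ℂ) (σ : Matrix ι ι ℂ) :
    logTrace (∑ x, (p x : ℂ) • ρ x) σ = ∑ x, p x * logTrace (ρ x) σ := by
  simp [logTrace, Matrix.sum_mul, Matrix.trace_sum]

theorem logTrace_smul_left (c : ℝ) (ρ σ : Matrix ι ι ℂ) :
    logTrace ((c : ℂ) • ρ) σ = c * logTrace ρ σ := by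
  simp [logTrace]

theorem IsSpectral.logTrace {V : Matrix ι κ ℂ} {s : κ → ℝ} {σ : Matrix ι ι ℂ}
    (h : IsSpectral V s σ) (ρ : Matrix ι ι ℂ) :
    logTrace ρ σ = ∑ k, Real.logb 2 (s k) * ((Vᴴ * ρ * V) k k).re := by
  rw [QInfo.logTrace, log2, h.cfc]
  have : (ρ * (V * diagonal (fun k => (Real.logb 2 (s k) : ℂ)) * Vᴴ)).trace =
      ((Vᴴ * ρ * V) * diagonal (fun k => (Real.logb 2 (s k) : ℂ))).trace := by
    rw [← Matrix.mul_assoc, Matrix.trace_mul_comm]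
    simp only [Matrix.mul_assoc]
  rw [this, trace, Complex.re_sum]
  refine Finset.sum_congr rfl fun k _ => ?_
  rw [diag_apply, mul_diagonal, mul_comm, Complex.re_ofReal_mul]

theorem logTrace_conj {W : Matrix ι' ι ℂ} (h1 : Wᴴ * W = 1) (h2 : W * Wᴴ = 1)
    (ρ : Matrix ι' ι' ℂ) {σ : Matrix ι ι ℂ} (hσ : σ.IsHermitian) :
    logTrace ρ (W * σ * Wᴴ) = logTrace (Wᴴ * ρ * W) σ := by
  obtain ⟨V, s, h⟩ := exists_isSpectral hσ
  rw [(h.conj h1 h2).logTrace, h.logTrace]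
  simp only [conjTranspose_mul, Matrix.mul_assoc]

theorem logTrace_submatrix (e : ι' ≃ ι) (ρ : Matrix ι ι ℂ) {σ : Matrix ι ι ℂ}
    (hσ : σ.IsHermitian) : logTrace (ρ.submatrix e e) (σ.submatrix e e) = logTrace ρ σ := by
  have h1 : ((1 : Matrix ι ι ℂ).submatrix e id)ᴴ * (1 : Matrix ι ι ℂ).submatrix e id = 1 := by
    rw [conjTranspose_submatrix, submatrix_mul_equiv]; simp
  have h2 : (1 : Matrix ι ι ℂ).submatrix e id * ((1 : Matrix ι ι ℂ).submatrix e id)ᴴ = 1 := by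
    rw [conjTranspose_submatrix, ← submatrix_mul _ _ _ _ _ Function.bijective_id]; simp
  have h3 (M : Matrix ι ι ℂ) : M.submatrix e e =
      (1 : Matrix ι ι ℂ).submatrix e id * M * ((1 : Matrix ι ι ℂ).submatrix e id)ᴴ := by
    rw [conjTranspose_submatrix]
    ext i j; simp [mul_apply, one_apply]
  rw [h3 σ, logTrace_conj h1 h2 _ hσ, h3 ρ]
  congr 1
  generalize (1 : Matrix ι ι ℂ).submatrix e id = W at *
  calc _ = (Wᴴ * W) * ρ * (Wᴴ * W) := by simp only [Matrix.mul_assoc]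
    _ = _ := by rw [h1, Matrix.one_mul, Matrix.mul_one]

theorem relEntropy_submatrix (e : ι' ≃ ι) {ρ σ : Matrix ι ι ℂ} (hρ : ρ.IsHermitian)
    (hσ : σ.IsHermitian) : relEntropy (ρ.submatrix e e) (σ.submatrix e e) = relEntropy ρ σ := by
  rw [relEntropy_eq, relEntropy_eq, logTrace_submatrix e _ hρ, logTrace_submatrix e _ hσ]

/-! ### Supports -/

/-- The support of `ρ` is contained in that of `σ`, expressed by the kernels of these (Hermitian)
matrices. -/
def SuppLE (ρ σ : Matrix ι ι ℂ) : Prop := ∀ v : ι → ℂ, σ *ᵥ v = 0 → ρ *ᵥ v = 0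

omit [DecidableEq ι] in
theorem SuppLE.refl (ρ : Matrix ι ι ℂ) : SuppLE ρ ρ := fun _ h => h

omit [DecidableEq ι] in
theorem SuppLE.trans {ρ σ τ : Matrix ι ι ℂ} (h : SuppLE ρ σ) (h' : SuppLE σ τ) : SuppLE ρ τ :=
  fun v hv => h v (h' v hv)

theorem IsSpectral.mulVec_col_eq_zero {V : Matrix ι κ ℂ} {s : κ → ℝ} {ρ σ : Matrix ι ι ℂ}
    (h : IsSpectral V s σ) (hs : SuppLE ρ σ) {k : κ} (hk : s k = 0) :
    ρ *ᵥ (V.col k) = 0 := by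
  apply hs
  have : σ * V = V * diagonal (fun k => (s k : ℂ)) := by
    rw [h.eq, Matrix.mul_assoc, h.star_mul, Matrix.mul_one]
  ext i
  have h2 := congrFun (congrFun this i) k
  rw [mul_diagonal, hk] at h2
  simpa [mul_apply, mulVec, dotProduct] using h2

theorem IsSpectral.suppLE {V : Matrix ι κ ℂ} {s : κ → ℝ} {ρ σ : Matrix ι ι ℂ}
    (h : IsSpectral V s σ) (hs : ∀ k, s k = 0 → ρ *ᵥ (V.col k) = 0) : SuppLE ρ σ := by
  intro v hv
  have h1 : v = V *ᵥ (Vᴴ *ᵥ v) := by rw [mulVec_mulVec, h.mul_star, one_mulVec]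
  have h2 (k : κ) : s k * (Vᴴ *ᵥ v) k = 0 := by
    have : (diagonal (fun k => (s k : ℂ))) *ᵥ (Vᴴ *ᵥ v) = Vᴴ *ᵥ (σ *ᵥ v) := by
      rw [mulVec_mulVec, mulVec_mulVec, h.eq, ← Matrix.mul_assoc, ← Matrix.mul_assoc, h.star_mul,
        Matrix.one_mul]
    rw [hv, mulVec_zero] at this
    simpa [mulVec_diagonal] using congrFun this k
  rw [h1, mulVec_mulVec]
  ext i
  rw [mulVec, dotProduct]
  refine Finset.sum_eq_zero fun k _ => ?_
  rcases mul_eq_zero.1 (h2 k) with h3 | h3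
  · have := congrFun (hs k (by exact_mod_cast h3)) i
    rw [show (ρ * V) i k = (ρ *ᵥ V.col k) i from rfl, this]; simp
  · simp [h3]

theorem IsSpectral.conj_apply_eq_zero {V : Matrix ι κ ℂ} {s : κ → ℝ} {ρ σ : Matrix ι ι ℂ}
    (h : IsSpectral V s σ) (hs : SuppLE ρ σ) {k : κ} (hk : s k = 0) (l : κ) :
    (Vᴴ * ρ * V) l k = 0 := by
  rw [Matrix.mul_assoc, mul_apply]
  refine Finset.sum_eq_zero fun i _ => ?_
  rw [show (ρ * V) i k = (ρ *ᵥ V.col k) i from rfl, h.mulVec_col_eq_zero hs hk]; simp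

theorem logTrace_smul_right {c : ℝ} (hc : c ≠ 0) {ρ σ : Matrix ι ι ℂ} (hσ : σ.IsHermitian)
    (hs : SuppLE ρ σ) :
    logTrace ρ ((c : ℂ) • σ) = Real.logb 2 c * ρ.trace.re + logTrace ρ σ := by
  obtain ⟨V, s, h⟩ := exists_isSpectral hσ
  have ht : ρ.trace.re = ∑ k, ((Vᴴ * ρ * V) k k).re := by
    rw [← Complex.re_sum]
    change _ = (trace (Vᴴ * ρ * V)).re
    rw [Matrix.trace_mul_comm, ← Matrix.mul_assoc, h.mul_star, Matrix.one_mul]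
  rw [(h.smul c).logTrace, h.logTrace, ht, Finset.mul_sum, ← Finset.sum_add_distrib]
  refine Finset.sum_congr rfl fun k _ => ?_
  by_cases hk : s k = 0
  · simp [h.conj_apply_eq_zero hs hk]
  · rw [Real.logb_mul hc hk]; ring

/-- Rescaling both arguments; valid for `c = 0` as well, where both sides vanish. -/
theorem relEntropy_smul_smul (c : ℝ) {ρ σ : Matrix ι ι ℂ} (hρ : ρ.IsHermitian)
    (hσ : σ.IsHermitian) (hs : SuppLE ρ σ) :
    relEntropy ((c : ℂ) • ρ) ((c : ℂ) • σ) = c * relEntropy ρ σ := by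
  by_cases hc : c = 0
  · simp [hc, relEntropy]
  · rw [relEntropy_eq, relEntropy_eq, logTrace_smul_left, logTrace_smul_left,
      logTrace_smul_right hc hρ (SuppLE.refl ρ), logTrace_smul_right hc hσ hs]
    ring

/-! ### Block-diagonal matrices -/

/-- The block-diagonal matrix `∑ₓ |x⟩⟨x| ⊗ Mₓ`. -/
def blocks (M : ξ → Matrix ι κ ℂ) : Matrix (ξ × ι) (ξ × κ) ℂ :=
  of fun i j => if i.1 = j.1 then M i.1 i.2 j.2 else 0

omit [Fintype ι] [Fintype κ] [DecidableEq ι] [DecidableEq κ] [Fintype ξ] in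
theorem blocks_apply (M : ξ → Matrix ι κ ℂ) (i : ξ × ι) (j : ξ × κ) :
    blocks M i j = if i.1 = j.1 then M i.1 i.2 j.2 else 0 := rfl

omit [Fintype ι] [DecidableEq ι] [DecidableEq κ] [Fintype ι'] [DecidableEq ι'] in
theorem blocks_mul (M : ξ → Matrix ι κ ℂ) (M' : ξ → Matrix κ ι' ℂ) :
    blocks M * blocks M' = blocks fun x => M x * M' x := by
  ext ⟨x, i⟩ ⟨y, j⟩
  simp only [mul_apply, blocks_apply, Fintype.sum_prod_type]
  rw [Finset.sum_eq_single x (fun z _ hz => by simp [hz.symm]) (by simp)]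
  by_cases h : x = y <;> simp [h]

omit [Fintype ι] [Fintype κ] [DecidableEq ι] [DecidableEq κ] [Fintype ξ] in
theorem blocks_conjTranspose (M : ξ → Matrix ι κ ℂ) : (blocks M)ᴴ = blocks fun x => (M x)ᴴ := by
  ext ⟨x, i⟩ ⟨y, j⟩
  by_cases h : x = y
  · subst h; simp [blocks_apply]
  · simp [blocks_apply, h, Ne.symm h]

omit [Fintype ι] [Fintype ξ] in
theorem blocks_one : blocks (fun _ : ξ => (1 : Matrix ι ι ℂ)) = 1 := by
  ext ⟨x, i⟩ ⟨y, j⟩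
  by_cases h : x = y <;> simp [blocks_apply, h, one_apply]

theorem isSpectral_blocks {V : ξ → Matrix ι κ ℂ} {s : ξ → κ → ℝ} {σ : ξ → Matrix ι ι ℂ}
    (h : ∀ x, IsSpectral (V x) (s x) (σ x)) :
    IsSpectral (blocks V) (fun k => s k.1 k.2) (blocks σ) where
  star_mul := by simp [blocks_conjTranspose, blocks_mul, (h _).star_mul, blocks_one]
  mul_star := by simp [blocks_conjTranspose, blocks_mul, (h _).mul_star, blocks_one]
  eq := by
    have : diagonal (fun k : ξ × κ => (s k.1 k.2 : ℂ)) =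
        blocks fun x => diagonal fun k => (s x k : ℂ) := by
      ext ⟨x, i⟩ ⟨y, j⟩
      by_cases h : x = y <;> simp [blocks_apply, h, diagonal_apply]
    rw [this, blocks_conjTranspose, blocks_mul, blocks_mul]
    congr 1; funext x; exact (h x).eq

omit [Fintype ι] [DecidableEq ι] [Fintype ξ] in
theorem blocks_isHermitian {σ : ξ → Matrix ι ι ℂ} (h : ∀ x, (σ x).IsHermitian) :
    (blocks σ).IsHermitian := by
  rw [IsHermitian, blocks_conjTranspose]
  congr 1; funext x; exact h x

omit [DecidableEq ι] in
theorem blocks_posSemidef {σ : ξ → Matrix ι ι ℂ} (h : ∀ x, (σ x).PosSemidef) :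
    (blocks σ).PosSemidef := by
  classical
  choose V s hV using fun x => exists_isSpectral (h x).isHermitian
  exact (isSpectral_blocks hV).posSemidef fun k => (hV k.1).eigenvalue_nonneg (h k.1) k.2

omit [DecidableEq ι] in
theorem blocks_suppLE {ρ σ : ξ → Matrix ι ι ℂ} (h : ∀ x, SuppLE (ρ x) (σ x)) :
    SuppLE (blocks ρ) (blocks σ) := by
  have key (M : ξ → Matrix ι ι ℂ) (v : ξ × ι → ℂ) (x : ξ) (i : ι) :
      (blocks M *ᵥ v) (x, i) = (M x *ᵥ fun j => v (x, j)) i := by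
    simp only [mulVec, dotProduct, blocks_apply, Fintype.sum_prod_type]
    rw [Finset.sum_eq_single x (fun z _ hz => by simp [hz.symm]) (by simp)]
    simp
  intro v hv
  ext ⟨x, i⟩
  rw [key]
  refine congrFun (h x _ ?_) i
  ext j
  rw [← key, hv]; rfl

/-- Only the diagonal blocks of `ρ` are seen by the logarithm of a block-diagonal matrix. -/
theorem logTrace_blocks_right (ρ : Matrix (ξ × ι) (ξ × ι) ℂ) {σ : ξ → Matrix ι ι ℂ}
    (h : ∀ x, (σ x).IsHermitian) :
    logTrace ρ (blocks σ) = ∑ x, logTrace (ρ.submatrix (x, ·) (x, ·)) (σ x) := by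
  choose V s hV using fun x => exists_isSpectral (h x)
  rw [(isSpectral_blocks hV).logTrace, Fintype.sum_prod_type]
  refine Finset.sum_congr rfl fun x _ => ?_
  rw [(hV x).logTrace]
  refine Finset.sum_congr rfl fun k _ => ?_
  congr 2
  rw [blocks_conjTranspose]
  simp only [mul_apply, blocks_apply, Fintype.sum_prod_type, submatrix_apply]
  rw [Finset.sum_eq_single x (fun z _ hz => by simp [hz]) (by simp)]
  refine Finset.sum_congr rfl fun i _ => ?_
  simp only [if_true]
  congr 1
  rw [Finset.sum_eq_single x (fun z _ hz => by simp [hz.symm]) (by simp)]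
  simp

theorem logTrace_blocks (ρ : ξ → Matrix ι ι ℂ) {σ : ξ → Matrix ι ι ℂ}
    (h : ∀ x, (σ x).IsHermitian) :
    logTrace (blocks ρ) (blocks σ) = ∑ x, logTrace (ρ x) (σ x) := by
  rw [logTrace_blocks_right _ h]
  refine Finset.sum_congr rfl fun x _ => ?_
  congr 1; ext i j; simp [blocks_apply]

theorem relEntropy_blocks {ρ σ : ξ → Matrix ι ι ℂ} (hρ : ∀ x, (ρ x).IsHermitian)
    (hσ : ∀ x, (σ x).IsHermitian) :
    relEntropy (blocks ρ) (blocks σ) = ∑ x, relEntropy (ρ x) (σ x) := by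
  simp only [relEntropy_eq, logTrace_blocks _ hρ, logTrace_blocks _ hσ, Finset.sum_sub_distrib]

end Spectral

/-! ### Two-positive maps and the Schwarz inequality -/

section DataProcessing

variable {ι κ ι' κ' : Type*} [Fintype ι] [Fintype κ] [DecidableEq ι] [DecidableEq κ]
  [Fintype ι'] [Fintype κ'] [DecidableEq ι'] [DecidableEq κ']

/-- Two-positivity of a linear map between matrix algebras: this is all that the monotonicity of the
relative entropy needs of a channel besides the preservation of the trace. -/
def TwoPositive (Φ : Matrix ι ι ℂ →ₗ[ℂ] Matrix κ κ ℂ) : Prop :=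
  ∀ M : Matrix (ι × Fin 2) (ι × Fin 2) ℂ, M.PosSemidef → (applyFst Φ M).PosSemidef

variable {Φ : Matrix ι ι ℂ →ₗ[ℂ] Matrix κ κ ℂ}

omit [Fintype κ] [DecidableEq ι] [DecidableEq κ] in
/-- The block matrix `(Φ (Sₐᴴ A S_b))` is positive semidefinite. -/
theorem TwoPositive.blockGram_posSemidef (h : TwoPositive Φ) {A : Matrix ι ι ℂ}
    (hA : A.PosSemidef) (S : Fin 2 → Matrix ι ι ℂ) :
    (of fun i j : κ × Fin 2 => Φ ((S i.2)ᴴ * A * S j.2) i.1 j.1).PosSemidef := by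
  have := h _ (hA.conjTranspose_mul_mul_same (of fun k (i : ι × Fin 2) => S i.2 k i.1))
  exact this

omit [DecidableEq ι] [DecidableEq κ] in
theorem TwoPositive.trace_nonneg (h : TwoPositive Φ) {A : Matrix ι ι ℂ}
    (hA : A.PosSemidef) (S : Fin 2 → Matrix ι ι ℂ) (R : Fin 2 → Matrix κ κ ℂ) :
    0 ≤ ∑ a, ∑ b, ((R a)ᴴ * Φ ((S a)ᴴ * A * S b) * R b).trace := by
  have := ((h.blockGram_posSemidef hA S).conjTranspose_mul_mul_same
    (of fun (i : κ × Fin 2) c => R i.2 i.1 c)).trace_nonneg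
  convert this using 1
  simp only [trace, diag_apply, mul_apply, conjTranspose_apply, of_apply, Fintype.sum_prod_type,
    Fin.sum_univ_two, Finset.sum_add_distrib, add_mul]
  ring

omit [Fintype κ] [DecidableEq κ] in
theorem TwoPositive.map_conjTranspose (h : TwoPositive Φ) (X : Matrix ι ι ℂ) :
    Φ Xᴴ = (Φ X)ᴴ := by
  have := (h.blockGram_posSemidef (PosSemidef.one (n := ι)) ![1, X]).isHermitian
  ext i j
  have h2 := congrFun (congrFun this (i, 1)) (j, 0)
  simpa using h2.symm

omit [Fintype κ] [DecidableEq ι] [DecidableEq κ] in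
theorem TwoPositive.posSemidef (h : TwoPositive Φ) {A : Matrix ι ι ℂ} (hA : A.PosSemidef) :
    (Φ A).PosSemidef := by
  classical
  have := (h.blockGram_posSemidef hA ![1, 1]).submatrix (fun i : κ => (i, (0 : Fin 2)))
  convert this using 1
  ext i j; simp

omit [DecidableEq κ] in
theorem exists_adjoint (Φ : Matrix ι ι ℂ →ₗ[ℂ] Matrix κ κ ℂ) (Y : Matrix κ κ ℂ) :
    ∃ Z : Matrix ι ι ℂ, ∀ X, (Zᴴ * X).trace = (Yᴴ * Φ X).trace := by
  refine ⟨of fun a b => star (Yᴴ * Φ (single a b 1)).trace, fun X => ?_⟩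
  conv_rhs => rw [matrix_eq_sum_single X]
  simp only [map_sum, Matrix.mul_sum, trace_sum]
  have (a b : ι) : (Yᴴ * Φ (single a b (X a b))).trace = (Yᴴ * Φ (single a b 1)).trace * X a b := by
    rw [show single a b (X a b) = X a b • single a b (1 : ℂ) by simp [smul_single], map_smul,
      Matrix.mul_smul, trace_smul, smul_eq_mul, mul_comm]
  simp only [this]
  rw [Finset.sum_comm]
  simp [trace, mul_apply]

/-- The Schwarz inequality `tr σ ZZᴴ ≤ tr Φ(σ) YYᴴ` for `Z = Φ†(Y)`. -/
theorem TwoPositive.schwarz_left (h : TwoPositive Φ) (ht : ∀ M, (Φ M).trace = M.trace)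
    {σ : Matrix ι ι ℂ} (hσ : σ.PosSemidef) {Y : Matrix κ κ ℂ} {Z : Matrix ι ι ℂ}
    (hZ : ∀ X, (Zᴴ * X).trace = (Yᴴ * Φ X).trace) :
    (Zᴴ * σ * Z).trace.re ≤ (Yᴴ * Φ σ * Y).trace.re := by
  -- The blocks `(Φ (Sₐᴴ σ S_b))` with `S = (1, -Z)` are tested against the column `(Y, 1)`.
  have h1 := (Complex.le_def.1 (h.trace_nonneg hσ ![1, -Z] ![Y, 1])).1
  have h2 : (Yᴴ * Φ (σ * Z)).trace = (Zᴴ * σ * Z).trace := by rw [← hZ, Matrix.mul_assoc]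
  have h3 : (Φ (Zᴴ * σ) * Y).trace = star (Zᴴ * σ * Z).trace := by
    rw [← h2, ← trace_conjTranspose, conjTranspose_mul, ← h.map_conjTranspose, conjTranspose_mul,
      hσ.isHermitian.eq, conjTranspose_conjTranspose]
  simp [Fin.sum_univ_two, h2, h3, ht] at h1
  linarith

/-- The Schwarz inequality `tr ρ ZᴴZ ≤ tr Φ(ρ) YᴴY` for `Z = Φ†(Y)`. -/
theorem TwoPositive.schwarz_right (h : TwoPositive Φ) (ht : ∀ M, (Φ M).trace = M.trace)
    {ρ : Matrix ι ι ℂ} (hρ : ρ.PosSemidef) {Y : Matrix κ κ ℂ} {Z : Matrix ι ι ℂ}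
    (hZ : ∀ X, (Zᴴ * X).trace = (Yᴴ * Φ X).trace) :
    (Z * ρ * Zᴴ).trace.re ≤ (Y * Φ ρ * Yᴴ).trace.re := by
  have h1 := (Complex.le_def.1 (h.trace_nonneg hρ ![1, -Zᴴ] ![Yᴴ, 1])).1
  have h2 : (Φ (Z * ρ) * Yᴴ).trace = (Z * ρ * Zᴴ).trace := by
    rw [trace_mul_comm, ← hZ, trace_mul_comm]
  have h3 : (Y * Φ (ρ * Zᴴ)).trace = star (Z * ρ * Zᴴ).trace := by
    rw [← h2, ← trace_conjTranspose, conjTranspose_mul, ← h.map_conjTranspose, conjTranspose_mul,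
      hρ.isHermitian.eq, conjTranspose_conjTranspose]
  simp [Fin.sum_univ_two, h2, h3, ht] at h1
  linarith

/-! ### A variational formula for the integrand of the relative entropy -/

/-- The concave functional of `Y` whose maximum is `⟨ρ, (L_σ + t R_ρ)⁻¹ ρ⟩`, where `L` and `R`
denote left and right multiplication. -/
noncomputable def variational (ρ σ : Matrix ι ι ℂ) (t : ℝ) (Y : Matrix ι ι ℂ) : ℝ :=
  2 * (Yᴴ * ρ).trace.re - (Yᴴ * σ * Y).trace.re - t * (Y * ρ * Yᴴ).trace.re

/-- The value of `⟨ρ, (L_σ + t R_ρ)⁻¹ ρ⟩` in terms of the eigenvalues `p` of `ρ` and `s` of `σ` and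
of the matrix `w` of overlaps of eigenvectors. -/
noncomputable def resolventForm (w : Matrix κ ι ℂ) (p : ι → ℝ) (s : κ → ℝ) (t : ℝ) : ℝ :=
  ∑ k, ∑ i, Complex.normSq (w k i) * p i * (p i / (s k + t * p i))

theorem variational_eq {U : Matrix ι κ' ℂ} {p : κ' → ℝ} {ρ : Matrix ι ι ℂ} (hρ : IsSpectral U p ρ)
    {V : Matrix ι κ ℂ} {s : κ → ℝ} {σ : Matrix ι ι ℂ} (hσ : IsSpectral V s σ) (t : ℝ)
    (y : Matrix κ κ' ℂ) :
    variational ρ σ t (V * y * Uᴴ) = ∑ k, ∑ i, (2 * p i * (star (y k i) * (Vᴴ * U) k i).re -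
      (s k + t * p i) * Complex.normSq (y k i)) := by
  have h1 : ((V * y * Uᴴ)ᴴ * ρ).trace =
      (yᴴ * ((Vᴴ * U) * diagonal (fun i => (p i : ℂ)))).trace := by
    rw [hρ.eq]
    calc _ = (U * (yᴴ * Vᴴ * U * diagonal (fun i => (p i : ℂ)) * Uᴴ)).trace := by
          simp only [conjTranspose_mul, conjTranspose_conjTranspose, Matrix.mul_assoc]
      _ = (yᴴ * Vᴴ * U * diagonal (fun i => (p i : ℂ)) * (Uᴴ * U)).trace := by
          rw [trace_mul_comm]; simp only [Matrix.mul_assoc]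
      _ = _ := by rw [hρ.star_mul, Matrix.mul_one]; simp only [Matrix.mul_assoc]
  have h2 : ((V * y * Uᴴ)ᴴ * σ * (V * y * Uᴴ)).trace =
      (yᴴ * (diagonal (fun k => (s k : ℂ)) * y)).trace := by
    calc _ = (U * (yᴴ * (Vᴴ * σ * V) * y * Uᴴ)).trace := by
          simp only [conjTranspose_mul, conjTranspose_conjTranspose, Matrix.mul_assoc]
      _ = (yᴴ * (Vᴴ * σ * V) * y * (Uᴴ * U)).trace := by
          rw [trace_mul_comm]; simp only [Matrix.mul_assoc]
      _ = _ := by rw [hρ.star_mul, Matrix.mul_one, hσ.conj_eq]; simp only [Matrix.mul_assoc]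
  have h3 : ((V * y * Uᴴ) * ρ * (V * y * Uᴴ)ᴴ).trace =
      (yᴴ * (y * diagonal (fun i => (p i : ℂ)))).trace := by
    calc _ = (V * (y * (Uᴴ * ρ * U) * yᴴ * Vᴴ)).trace := by
          simp only [conjTranspose_mul, conjTranspose_conjTranspose, Matrix.mul_assoc]
      _ = (y * (Uᴴ * ρ * U) * yᴴ * (Vᴴ * V)).trace := by
          rw [trace_mul_comm]; simp only [Matrix.mul_assoc]
      _ = _ := by rw [hσ.star_mul, Matrix.mul_one, hρ.conj_eq, trace_mul_comm]
  have key (N : Matrix κ κ' ℂ) : (yᴴ * N).trace.re = ∑ k, ∑ i, (star (y k i) * N k i).re := by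
    rw [Finset.sum_comm]; simp [trace, mul_apply]
  rw [variational, h1, h2, h3, key, key, key, Finset.mul_sum, Finset.mul_sum,
    ← Finset.sum_sub_distrib, ← Finset.sum_sub_distrib]
  refine Finset.sum_congr rfl fun k _ => ?_
  rw [Finset.mul_sum, Finset.mul_sum, ← Finset.sum_sub_distrib, ← Finset.sum_sub_distrib]
  refine Finset.sum_congr rfl fun i _ => ?_
  rw [mul_diagonal, mul_diagonal, diagonal_mul]
  simp only [Complex.star_def, Complex.mul_re, Complex.conj_re, Complex.conj_im, Complex.ofReal_re,
    Complex.ofReal_im, Complex.mul_im, Complex.normSq_apply]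
  ring

theorem two_mul_re_sub_le (y w : ℂ) {p d : ℝ} (hd : 0 ≤ d) (hp : d = 0 → p = 0) :
    2 * p * (star y * w).re - d * Complex.normSq y ≤ Complex.normSq w * p * (p / d) := by
  rcases hd.eq_or_lt with h | h
  · simp [← h, hp h.symm]
  · have h1 : Complex.normSq w * p * (p / d) = (Complex.normSq w * p ^ 2) / d := by ring
    rw [h1, le_div_iff₀ h]
    have h2 := Complex.normSq_nonneg (d * y - p * w)
    simp only [Complex.star_def, Complex.mul_re, Complex.conj_re, Complex.conj_im,
      Complex.ofReal_re, Complex.ofReal_im, Complex.mul_im, Complex.normSq_apply, Complex.sub_re,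
      Complex.sub_im] at h2 ⊢
    nlinarith [h2]

theorem variational_le {U : Matrix ι κ' ℂ} {p : κ' → ℝ} {ρ : Matrix ι ι ℂ} (hρ : IsSpectral U p ρ)
    {V : Matrix ι κ ℂ} {s : κ → ℝ} {σ : Matrix ι ι ℂ} (hσ : IsSpectral V s σ)
    (hp : ∀ i, 0 ≤ p i) (hs : ∀ k, 0 ≤ s k) {t : ℝ} (ht : 0 < t) (Y : Matrix ι ι ℂ) :
    variational ρ σ t Y ≤ resolventForm (Vᴴ * U) p s t := by
  have hY : Y = V * (Vᴴ * Y * U) * Uᴴ := by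
    calc Y = (V * Vᴴ) * Y * (U * Uᴴ) := by
          rw [hσ.mul_star, hρ.mul_star, Matrix.one_mul, Matrix.mul_one]
      _ = _ := by simp only [Matrix.mul_assoc]
  rw [hY, variational_eq hρ hσ]
  refine Finset.sum_le_sum fun k _ => Finset.sum_le_sum fun i _ => ?_
  have h1 := mul_nonneg ht.le (hp i)
  refine two_mul_re_sub_le _ _ (add_nonneg (hs k) h1) fun h => ?_
  have : t * p i = 0 := by linarith [hs k]
  exact (mul_eq_zero.1 this).resolve_left ht.ne'

theorem exists_variational_eq {U : Matrix ι κ' ℂ} {p : κ' → ℝ} {ρ : Matrix ι ι ℂ}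
    (hρ : IsSpectral U p ρ) {V : Matrix ι κ ℂ} {s : κ → ℝ} {σ : Matrix ι ι ℂ}
    (hσ : IsSpectral V s σ) (t : ℝ) :
    ∃ Y, variational ρ σ t Y = resolventForm (Vᴴ * U) p s t := by
  -- In eigenbases the maximum over each matrix entry is elementary.
  refine ⟨V * (of fun k i => ((p i / (s k + t * p i) : ℝ) : ℂ) * (Vᴴ * U) k i) * Uᴴ, ?_⟩
  rw [variational_eq hρ hσ]
  refine Finset.sum_congr rfl fun k _ => Finset.sum_congr rfl fun i _ => ?_
  rw [of_apply]
  generalize (Vᴴ * U) k i = w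
  have h : (s k + t * p i) * (p i / (s k + t * p i)) ^ 2 = p i * (p i / (s k + t * p i)) := by
    by_cases h0 : s k + t * p i = 0
    · simp [h0]
    · field_simp
  simp only [Complex.star_def, Complex.mul_re, Complex.conj_re, Complex.conj_im,
    Complex.ofReal_re, Complex.ofReal_im, Complex.mul_im, Complex.normSq_apply]
  linear_combination (-(w.re ^ 2 + w.im ^ 2)) * h

/-- The resolvent form decreases under two-positive trace-preserving maps: pull a maximizer for the
output back by the adjoint map. -/
theorem TwoPositive.resolventForm_le (h : TwoPositive Φ) (htr : ∀ M, (Φ M).trace = M.trace)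
    {U V : Matrix ι ι ℂ} {p s : ι → ℝ} {ρ σ : Matrix ι ι ℂ} (hρ : IsSpectral U p ρ)
    (hσ : IsSpectral V s σ) (hρ0 : ρ.PosSemidef) (hσ0 : σ.PosSemidef)
    {U' V' : Matrix κ κ ℂ} {p' s' : κ → ℝ} (hρ' : IsSpectral U' p' (Φ ρ))
    (hσ' : IsSpectral V' s' (Φ σ)) {t : ℝ} (ht : 0 < t) :
    resolventForm (V'ᴴ * U') p' s' t ≤ resolventForm (Vᴴ * U) p s t := by
  obtain ⟨Y, hY⟩ := exists_variational_eq hρ' hσ' t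
  obtain ⟨Z, hZ⟩ := exists_adjoint Φ Y
  rw [← hY]
  refine le_trans ?_ (variational_le hρ hσ (hρ.eigenvalue_nonneg hρ0) (hσ.eigenvalue_nonneg hσ0)
    ht Z)
  have h1 := h.schwarz_left htr hσ0 hZ
  have h2 := mul_le_mul_of_nonneg_left (h.schwarz_right htr hρ0 hZ) ht.le
  rw [variational, variational, hZ]
  linarith

/-! ### Monotonicity of the relative entropy -/

section Overlaps

variable {U : Matrix ι κ' ℂ} {p : κ' → ℝ} {ρ : Matrix ι ι ℂ} {V : Matrix ι κ ℂ} {s : κ → ℝ}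
  {σ : Matrix ι ι ℂ}

theorem IsSpectral.sum_normSq_overlap (hρ : IsSpectral U p ρ) (hσ : IsSpectral V s σ) (i : κ') :
    ∑ k, Complex.normSq ((Vᴴ * U) k i) = 1 := by
  have h : (Vᴴ * U)ᴴ * (Vᴴ * U) = 1 := by
    calc _ = Uᴴ * (V * Vᴴ) * U := by
          simp only [conjTranspose_mul, conjTranspose_conjTranspose, Matrix.mul_assoc]
      _ = _ := by rw [hσ.mul_star, Matrix.mul_one, hρ.star_mul]
  have h2 := congrArg Complex.re (congrFun (congrFun h i) i)
  rw [mul_apply, Complex.re_sum] at h2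
  simpa [Complex.normSq_apply] using h2

theorem IsSpectral.sum_normSq_overlap' (hρ : IsSpectral U p ρ) (hσ : IsSpectral V s σ) (k : κ) :
    ∑ i, Complex.normSq ((Vᴴ * U) k i) = 1 := by
  rw [← hσ.sum_normSq_overlap hρ k]
  refine Finset.sum_congr rfl fun i _ => ?_
  rw [← Complex.normSq_conj, ← Complex.star_def, ← conjTranspose_apply, conjTranspose_mul,
    conjTranspose_conjTranspose]

omit [Fintype κ] [DecidableEq κ] in
theorem IsSpectral.conj_apply_self (hρ : IsSpectral U p ρ) (V : Matrix ι κ ℂ) (k : κ) :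
    ((Vᴴ * ρ * V) k k).re = ∑ i, Complex.normSq ((Vᴴ * U) k i) * p i := by
  have h : Vᴴ * ρ * V = (Vᴴ * U) * diagonal (fun i => (p i : ℂ)) * (Vᴴ * U)ᴴ := by
    rw [hρ.eq]; simp only [conjTranspose_mul, conjTranspose_conjTranspose, Matrix.mul_assoc]
  rw [h, mul_apply, Complex.re_sum]
  refine Finset.sum_congr rfl fun i _ => ?_
  rw [mul_diagonal, conjTranspose_apply]
  simp only [Complex.star_def, Complex.mul_re, Complex.conj_re, Complex.conj_im,
    Complex.ofReal_re, Complex.ofReal_im, Complex.mul_im, Complex.normSq_apply]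
  ring

theorem IsSpectral.logTrace_self (hρ : IsSpectral U p ρ) :
    QInfo.logTrace ρ ρ = ∑ i, p i * Real.logb 2 (p i) := by
  rw [hρ.logTrace, hρ.conj_eq]
  exact Finset.sum_congr rfl fun i _ => by simp [mul_comm]

theorem relEntropy_eq_sum (hρ : IsSpectral U p ρ) (hσ : IsSpectral V s σ) :
    relEntropy ρ σ = ∑ k, ∑ i, Complex.normSq ((Vᴴ * U) k i) * p i *
      (Real.logb 2 (p i) - Real.logb 2 (s k)) := by
  have h1 : logTrace ρ ρ = ∑ k, ∑ i, Complex.normSq ((Vᴴ * U) k i) * p i * Real.logb 2 (p i) := by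
    rw [hρ.logTrace_self, Finset.sum_comm]
    refine Finset.sum_congr rfl fun i _ => ?_
    simp only [mul_assoc]
    rw [← Finset.sum_mul, hρ.sum_normSq_overlap hσ, one_mul]
  have h2 : logTrace ρ σ = ∑ k, ∑ i, Complex.normSq ((Vᴴ * U) k i) * p i * Real.logb 2 (s k) := by
    rw [hσ.logTrace]
    refine Finset.sum_congr rfl fun k _ => ?_
    rw [hρ.conj_apply_self, Finset.mul_sum]
    exact Finset.sum_congr rfl fun i _ => by ring
  rw [relEntropy_eq, h1, h2]
  simp only [← Finset.sum_sub_distrib, mul_sub]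

theorem sum_overlap_mul (hρ : IsSpectral U p ρ) (hσ : IsSpectral V s σ) :
    ∑ k, ∑ i, Complex.normSq ((Vᴴ * U) k i) * p i = ρ.trace.re := by
  rw [Finset.sum_comm, ← hρ.sum_eigenvalues]
  refine Finset.sum_congr rfl fun i _ => ?_
  rw [← Finset.sum_mul, hρ.sum_normSq_overlap hσ, one_mul]

/-- Inclusion of supports: an eigenvector of `ρ` with positive eigenvalue is orthogonal to the
kernel of `σ`. -/
theorem overlap_mul_eq_zero_or_pos (hρ : IsSpectral U p ρ) (hσ : IsSpectral V s σ)
    (hp : ∀ i, 0 ≤ p i) (hs : ∀ k, 0 ≤ s k) (h : SuppLE ρ σ) (k : κ) (i : κ') :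
    Complex.normSq ((Vᴴ * U) k i) * p i = 0 ∨ (0 < p i ∧ 0 < s k) := by
  have h0 (i : κ') : 0 ≤ Complex.normSq ((Vᴴ * U) k i) * p i :=
    mul_nonneg (Complex.normSq_nonneg _) (hp i)
  rcases (hs k).eq_or_lt with hk | hk
  · left
    have h1 := hρ.conj_apply_self V k
    rw [hσ.conj_apply_eq_zero h hk.symm, Complex.zero_re] at h1
    exact (Finset.sum_eq_zero_iff_of_nonneg fun i _ => h0 i).1 h1.symm i (Finset.mem_univ i)
  · rcases (hp i).eq_or_lt with hi | hi
    · left; rw [← hi, mul_zero]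
    · exact Or.inr ⟨hi, hk⟩

/-- Klein's inequality. -/
theorem relEntropy_nonneg (hρ : ρ.PosSemidef) (hσ : σ.PosSemidef) (h : SuppLE ρ σ)
    (ht : σ.trace = ρ.trace) : 0 ≤ relEntropy ρ σ := by
  obtain ⟨U, p, hU⟩ := exists_isSpectral hρ.isHermitian
  obtain ⟨V, s, hV⟩ := exists_isSpectral hσ.isHermitian
  have hp := hU.eigenvalue_nonneg hρ
  have hs := hV.eigenvalue_nonneg hσ
  have hl : 0 < Real.log 2 := Real.log_pos one_lt_two
  have h1 : ∑ k, ∑ i, Complex.normSq ((Vᴴ * U) k i) * s k = ρ.trace.re := by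
    rw [← ht, ← hV.sum_eigenvalues]
    refine Finset.sum_congr rfl fun i _ => ?_
    rw [← Finset.sum_mul, hU.sum_normSq_overlap' hV, one_mul]
  have h2 : 0 = ∑ k, ∑ i, (Complex.normSq ((Vᴴ * U) k i) * p i -
      Complex.normSq ((Vᴴ * U) k i) * s k) / Real.log 2 := by
    simp only [← Finset.sum_div, Finset.sum_sub_distrib]
    rw [sum_overlap_mul hU hV, h1, sub_self, zero_div]
  rw [relEntropy_eq_sum hU hV, h2]
  refine Finset.sum_le_sum fun k _ => Finset.sum_le_sum fun i _ => ?_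
  have hw := Complex.normSq_nonneg ((Vᴴ * U) k i)
  rw [div_le_iff₀ hl]
  rcases overlap_mul_eq_zero_or_pos hU hV hp hs h k i with h0 | ⟨hpi, hsk⟩
  · rw [h0, zero_mul, zero_mul, zero_sub, neg_nonpos]
    exact mul_nonneg hw (hs k)
  · have h3 := Real.log_le_sub_one_of_pos (div_pos hsk hpi)
    rw [Real.log_div hsk.ne' hpi.ne'] at h3
    have h4 : p i * (Real.log (s k) - Real.log (p i)) ≤ s k - p i := by
      refine (mul_le_mul_of_nonneg_left h3 hpi.le).trans_eq ?_
      field_simp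
    have h5 : (Real.logb 2 (p i) - Real.logb 2 (s k)) * Real.log 2 =
        Real.log (p i) - Real.log (s k) := by
      rw [sub_mul, Real.logb, Real.logb, div_mul_cancel₀ _ hl.ne', div_mul_cancel₀ _ hl.ne']
    rw [mul_assoc, h5]
    nlinarith [mul_le_mul_of_nonneg_left h4 hw]

/-- An antiderivative, as a function of `t`, of the resolvent form. -/
noncomputable def logForm (w : Matrix κ κ' ℂ) (p : κ' → ℝ) (s : κ → ℝ) (t : ℝ) : ℝ :=
  ∑ k, ∑ i, Complex.normSq (w k i) * p i * (Real.log (s k + t * p i) - Real.log (s k))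

omit [DecidableEq κ] [DecidableEq κ'] in
theorem logForm_zero (w : Matrix κ κ' ℂ) (p : κ' → ℝ) (s : κ → ℝ) : logForm w p s 0 = 0 := by
  simp [logForm]

omit [DecidableEq κ] [DecidableEq κ'] in
theorem hasDerivAt_logForm {w : Matrix κ κ' ℂ} {p : κ' → ℝ} {s : κ → ℝ}
    (h : ∀ k i, Complex.normSq (w k i) * p i = 0 ∨ (0 < p i ∧ 0 < s k)) {t : ℝ} (ht : 0 ≤ t) :
    HasDerivAt (logForm w p s) (resolventForm w p s t) t := by
  refine HasDerivAt.fun_sum fun k _ => HasDerivAt.fun_sum fun i _ => ?_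
  rcases h k i with h0 | ⟨hp, hs⟩
  · simp only [h0, zero_mul]
    exact hasDerivAt_const t 0
  · refine HasDerivAt.const_mul _ ?_
    have h1 : HasDerivAt (fun t : ℝ => s k + t * p i) (p i) t := by
      simpa using ((hasDerivAt_id t).mul_const (p i)).const_add (s k)
    exact (h1.log (by positivity)).sub_const _

/-- The relative entropy as a limit of integrals of the resolvent form. -/
theorem tendsto_logForm (hρ : IsSpectral U p ρ) (hσ : IsSpectral V s σ)
    (h : ∀ k i, Complex.normSq ((Vᴴ * U) k i) * p i = 0 ∨ (0 < p i ∧ 0 < s k)) :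
    Filter.Tendsto (fun t => logForm (Vᴴ * U) p s t - ρ.trace.re * Real.log t) Filter.atTop
      (nhds (Real.log 2 * relEntropy ρ σ)) := by
  rw [relEntropy_eq_sum hρ hσ, ← sum_overlap_mul hρ hσ, Finset.mul_sum]
  simp only [logForm, Finset.sum_mul, ← Finset.sum_sub_distrib]
  refine tendsto_finsetSum _ fun k _ => ?_
  rw [Finset.mul_sum]
  refine tendsto_finsetSum _ fun i _ => ?_
  rcases h k i with h0 | ⟨hp, hs⟩
  · simp [h0]
  · have hl : Real.log 2 ≠ 0 := (Real.log_pos one_lt_two).ne'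
    have h1 : Filter.Tendsto (fun t : ℝ => Real.log (s k / t + p i) - Real.log (s k)) Filter.atTop
        (nhds (Real.log (0 + p i) - Real.log (s k))) :=
      (((tendsto_const_nhds.div_atTop Filter.tendsto_id).add_const _).log
        (by simpa using hp.ne')).sub_const _
    have h2 := h1.const_mul (Complex.normSq ((Vᴴ * U) k i) * p i)
    refine (h2.congr' ?_).trans_eq ?_
    · filter_upwards [Filter.eventually_gt_atTop 0] with t ht
      have : s k / t + p i = (s k + t * p i) / t := by field_simp
      rw [this, Real.log_div (by positivity) ht.ne']
      ring
    · congr 1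
      rw [zero_add, Real.logb, Real.logb]
      field_simp

end Overlaps

/-- The data-processing inequality. -/
theorem TwoPositive.relEntropy_le {Φ : Matrix ι ι ℂ →ₗ[ℂ] Matrix κ κ ℂ} (h : TwoPositive Φ)
    (htr : ∀ M, (Φ M).trace = M.trace) {ρ σ : Matrix ι ι ℂ} (hρ : ρ.PosSemidef)
    (hσ : σ.PosSemidef) (hs : SuppLE ρ σ) (hs' : SuppLE (Φ ρ) (Φ σ)) :
    relEntropy (Φ ρ) (Φ σ) ≤ relEntropy ρ σ := by
  obtain ⟨U, p, hU⟩ := exists_isSpectral hρ.isHermitian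
  obtain ⟨V, s, hV⟩ := exists_isSpectral hσ.isHermitian
  obtain ⟨U', p', hU'⟩ := exists_isSpectral (h.posSemidef hρ).isHermitian
  obtain ⟨V', s', hV'⟩ := exists_isSpectral (h.posSemidef hσ).isHermitian
  have h1 := overlap_mul_eq_zero_or_pos hU hV (hU.eigenvalue_nonneg hρ)
    (hV.eigenvalue_nonneg hσ) hs
  have h2 := overlap_mul_eq_zero_or_pos hU' hV' (hU'.eigenvalue_nonneg (h.posSemidef hρ))
    (hV'.eigenvalue_nonneg (h.posSemidef hσ)) hs'
  have hd (t : ℝ) (ht : 0 ≤ t) := (hasDerivAt_logForm h1 ht).sub (hasDerivAt_logForm h2 ht)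
  have hmono : MonotoneOn (logForm (Vᴴ * U) p s - logForm (V'ᴴ * U') p' s') (Set.Ici 0) := by
    refine monotoneOn_of_deriv_nonneg (convex_Ici 0)
      (fun t ht => (hd t ht).continuousAt.continuousWithinAt)
      (fun t ht => (hd t (interior_subset ht)).differentiableAt.differentiableWithinAt)
      fun t ht => ?_
    rw [(hd t (interior_subset ht)).deriv, sub_nonneg]
    rw [interior_Ici] at ht
    exact h.resolventForm_le htr hU hV hρ hσ hU' hV' ht
  have hle : Real.log 2 * relEntropy (Φ ρ) (Φ σ) ≤ Real.log 2 * relEntropy ρ σ := by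
    refine le_of_tendsto_of_tendsto (tendsto_logForm hU' hV' h2) (tendsto_logForm hU hV h1) ?_
    filter_upwards [Filter.eventually_ge_atTop 0] with t ht
    have := hmono (Set.mem_Ici.2 le_rfl) (Set.mem_Ici.2 ht) ht
    simp only [Pi.sub_apply, logForm_zero, sub_zero] at this
    rw [htr]
    linarith
  exact le_of_mul_le_mul_left hle (Real.log_pos one_lt_two)

end DataProcessing

/-! ### Partial traces and product states -/

section PartialTrace

variable {α β ξ : Type*} [Fintype α] [Fintype β] [Fintype ξ]

/-- The partial trace over the first system as a linear map. -/
def trFstLinear (α β : Type*) [Fintype α] : Matrix (α × β) (α × β) ℂ →ₗ[ℂ] Matrix β β ℂ where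
  toFun := trFst
  map_add' M M' := by ext i j; simp [trFst, Finset.sum_add_distrib]
  map_smul' c M := by ext i j; simp [trFst, Finset.mul_sum]

/-- The partial trace over the second system as a linear map. -/
def trSndLinear (α β : Type*) [Fintype β] : Matrix (α × β) (α × β) ℂ →ₗ[ℂ] Matrix α α ℂ where
  toFun := trSnd
  map_add' M M' := by ext i j; simp [trSnd, Finset.sum_add_distrib]
  map_smul' c M := by ext i j; simp [trSnd, Finset.mul_sum]

omit [Fintype β] in
theorem trFst_sum_smul (p : ξ → ℝ) (M : ξ → Matrix (α × β) (α × β) ℂ) :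
    trFst (∑ x, (p x : ℂ) • M x) = ∑ x, (p x : ℂ) • trFst (M x) := by
  have h := map_sum (trFstLinear α β) (fun x => (p x : ℂ) • M x) Finset.univ
  simp only [map_smul] at h
  exact h

omit [Fintype α] in
theorem trSnd_sum_smul (p : ξ → ℝ) (M : ξ → Matrix (α × β) (α × β) ℂ) :
    trSnd (∑ x, (p x : ℂ) • M x) = ∑ x, (p x : ℂ) • trSnd (M x) := by
  have h := map_sum (trSndLinear α β) (fun x => (p x : ℂ) • M x) Finset.univ
  simp only [map_smul] at h
  exact h

theorem trace_trFst (M : Matrix (α × β) (α × β) ℂ) : (trFst M).trace = M.trace := by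
  simp only [trace, trFst, diag_apply, of_apply, Fintype.sum_prod_type]
  exact Finset.sum_comm

theorem trace_trSnd (M : Matrix (α × β) (α × β) ℂ) : (trSnd M).trace = M.trace := by
  simp only [trace, trSnd, diag_apply, of_apply, Fintype.sum_prod_type]

omit [Fintype β] in
theorem trFst_posSemidef {M : Matrix (α × β) (α × β) ℂ} (h : M.PosSemidef) :
    (trFst M).PosSemidef := by
  have : trFst M = ∑ a, M.submatrix (a, ·) (a, ·) := by
    ext i j; simp [trFst, Matrix.sum_apply]
  rw [this]
  exact posSemidef_sum _ fun a _ => h.submatrix _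

omit [Fintype α] in
theorem trSnd_posSemidef {M : Matrix (α × β) (α × β) ℂ} (h : M.PosSemidef) :
    (trSnd M).PosSemidef := by
  have : trSnd M = ∑ b, M.submatrix (·, b) (·, b) := by
    ext i j; simp [trSnd, Matrix.sum_apply]
  rw [this]
  exact posSemidef_sum _ fun b _ => h.submatrix _

theorem IsState.trFst {M : Matrix (α × β) (α × β) ℂ} (h : IsState M) : IsState (trFst M) :=
  ⟨trFst_posSemidef h.1, by rw [trace_trFst, h.2]⟩

theorem IsState.trSnd {M : Matrix (α × β) (α × β) ℂ} (h : IsState M) : IsState (trSnd M) :=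
  ⟨trSnd_posSemidef h.1, by rw [trace_trSnd, h.2]⟩

omit [Fintype β] in
theorem twoPositive_trFstLinear : TwoPositive (trFstLinear α β) := by
  intro M hM
  have : applyFst (trFstLinear α β) M =
      ∑ a, M.submatrix (fun i : β × Fin 2 => ((a, i.1), i.2)) (fun i => ((a, i.1), i.2)) := by
    ext i j
    simp [applyFst, trFstLinear, QInfo.trFst, Matrix.sum_apply]
  rw [this]
  exact posSemidef_sum _ fun a _ => hM.submatrix _

theorem trace_kronecker_one_mul [DecidableEq β] (X : Matrix α α ℂ) (M : Matrix (α × β) (α × β) ℂ) :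
    ((X ⊗ₖ (1 : Matrix β β ℂ)) * M).trace = (X * trSnd M).trace := by
  simp only [trace, diag_apply, mul_apply, trSnd, of_apply, Fintype.sum_prod_type,
    kroneckerMap_apply, one_apply, mul_ite, mul_one, mul_zero, ite_mul, zero_mul, Finset.sum_ite_eq,
    Finset.mem_univ, if_true, Finset.mul_sum]
  exact Finset.sum_congr rfl fun a _ => Finset.sum_comm

theorem trace_one_kronecker_mul [DecidableEq α] (X : Matrix β β ℂ) (M : Matrix (α × β) (α × β) ℂ) :
    (((1 : Matrix α α ℂ) ⊗ₖ X) * M).trace = (X * trFst M).trace := by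
  simp only [trace, diag_apply, mul_apply, trFst, of_apply, Fintype.sum_prod_type,
    kroneckerMap_apply, one_apply, ite_mul, one_mul, zero_mul, Finset.mul_sum]
  rw [Finset.sum_comm]
  refine Finset.sum_congr rfl fun b _ => ?_
  rw [Finset.sum_comm]
  conv_rhs => rw [Finset.sum_comm]
  rw [Finset.sum_comm]
  refine Finset.sum_congr rfl fun a _ => ?_
  rw [Finset.sum_comm]
  exact Finset.sum_congr rfl fun b' _ => by simp

end PartialTrace

section Supports

variable {ι ξ : Type*} [Fintype ι] [Fintype ξ]

theorem mulVec_eq_zero_of_re {A : Matrix ι ι ℂ} (hA : A.PosSemidef) {v : ι → ℂ}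
    (h : (star v ⬝ᵥ (A *ᵥ v)).re = 0) : A *ᵥ v = 0 := by
  classical
  rw [← hA.dotProduct_mulVec_zero_iff]
  have := Complex.le_def.1 (hA.dotProduct_mulVec_nonneg v)
  exact Complex.ext h this.2.symm

theorem suppLE_sum {A : ξ → Matrix ι ι ℂ} (hA : ∀ x, (A x).PosSemidef) (x : ξ) :
    SuppLE (A x) (∑ x, A x) := by
  intro v hv
  apply mulVec_eq_zero_of_re (hA x)
  have h0 (y : ξ) : 0 ≤ (star v ⬝ᵥ (A y *ᵥ v)).re :=
    (Complex.le_def.1 ((hA y).dotProduct_mulVec_nonneg v)).1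
  have h1 : ∑ y, (star v ⬝ᵥ (A y *ᵥ v)).re = 0 := by
    rw [← Complex.re_sum, ← dotProduct_sum, ← Matrix.sum_mulVec, hv, dotProduct_zero,
      Complex.zero_re]
  exact (Finset.sum_eq_zero_iff_of_nonneg fun y _ => h0 y).1 h1 x (Finset.mem_univ x)

omit [Fintype ξ] in
theorem SuppLE.smul {A B : Matrix ι ι ℂ} {c : ℝ} (h : c ≠ 0 → SuppLE A B) :
    SuppLE ((c : ℂ) • A) ((c : ℂ) • B) := by
  intro v hv
  by_cases hc : c = 0
  · simp [hc]
  · rw [smul_mulVec] at hv ⊢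
    rw [h hc v ((smul_eq_zero.1 hv).resolve_left (by exact_mod_cast hc)), smul_zero]

omit [Fintype ι] [Fintype ξ] in
theorem posSemidef_ofReal_smul {A : Matrix ι ι ℂ} (hA : A.PosSemidef) {c : ℝ} (hc : 0 ≤ c) :
    ((c : ℂ) • A).PosSemidef :=
  hA.smul (by exact_mod_cast hc)

omit [Fintype ι] in
theorem sum_smul_posSemidef {p : ξ → ℝ} (hp : ∀ x, 0 ≤ p x) {A : ξ → Matrix ι ι ℂ}
    (hA : ∀ x, (A x).PosSemidef) : (∑ x, (p x : ℂ) • A x).PosSemidef :=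
  posSemidef_sum _ fun x _ => posSemidef_ofReal_smul (hA x) (hp x)

theorem suppLE_sum_smul {p : ξ → ℝ} (hp : ∀ x, 0 ≤ p x) {A : ξ → Matrix ι ι ℂ}
    (hA : ∀ x, (A x).PosSemidef) {x : ξ} (hx : p x ≠ 0) :
    SuppLE (A x) (∑ x, (p x : ℂ) • A x) := by
  intro v hv
  have := suppLE_sum (fun x => posSemidef_ofReal_smul (hA x) (hp x)) x v hv
  rw [smul_mulVec] at this
  exact (smul_eq_zero.1 this).resolve_left (by exact_mod_cast hx)

theorem IsState.sum_smul {p : ξ → ℝ} (hp : p ∈ stdSimplex ℝ ξ) {A : ξ → Matrix ι ι ℂ}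
    (hA : ∀ x, IsState (A x)) : IsState (∑ x, (p x : ℂ) • A x) :=
  ⟨sum_smul_posSemidef hp.1 fun x => (hA x).1, by
    simp only [trace_sum, trace_smul, (hA _).2, smul_eq_mul, mul_one]
    exact_mod_cast hp.2⟩

end Supports

section Product

variable {α β : Type*} [Fintype α] [Fintype β] [DecidableEq α] [DecidableEq β]

theorem sum_conj_kronecker_snd (V : Matrix α α ℂ) {W : Matrix β β ℂ} (hW : W * Wᴴ = 1)
    (M : Matrix (α × β) (α × β) ℂ) (k : α) :
    ∑ l, ((V ⊗ₖ W)ᴴ * M * (V ⊗ₖ W)) (k, l) (k, l) = (Vᴴ * trSnd M * V) k k := by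
  have h (N : Matrix (α × β) (α × β) ℂ) : ∑ l, N (k, l) (k, l) = (trSnd N) k k := rfl
  have h2 (N : Matrix α α ℂ) : N k k = (single k k 1 * N).trace := by
    rw [trace_single_mul, one_smul]
  rw [h, h2 (trSnd _), ← trace_kronecker_one_mul, h2 (Vᴴ * trSnd M * V)]
  calc _ = ((V ⊗ₖ W) * (single k k 1 ⊗ₖ 1) * (V ⊗ₖ W)ᴴ * M).trace := by
        rw [← Matrix.mul_assoc, trace_mul_comm]; simp only [Matrix.mul_assoc]
    _ = (((V * single k k 1 * Vᴴ) ⊗ₖ 1) * M).trace := by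
        rw [conjTranspose_kronecker, ← mul_kronecker_mul, ← mul_kronecker_mul, Matrix.mul_one, hW]
    _ = _ := by
        rw [trace_kronecker_one_mul, Matrix.mul_assoc, Matrix.mul_assoc, trace_mul_comm]
        simp only [Matrix.mul_assoc]

theorem sum_conj_kronecker_fst {V : Matrix α α ℂ} (hV : V * Vᴴ = 1) (W : Matrix β β ℂ)
    (M : Matrix (α × β) (α × β) ℂ) (l : β) :
    ∑ k, ((V ⊗ₖ W)ᴴ * M * (V ⊗ₖ W)) (k, l) (k, l) = (Wᴴ * trFst M * W) l l := by
  have h (N : Matrix (α × β) (α × β) ℂ) : ∑ k, N (k, l) (k, l) = (trFst N) l l := rfl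
  have h2 (N : Matrix β β ℂ) : N l l = (single l l 1 * N).trace := by
    rw [trace_single_mul, one_smul]
  rw [h, h2 (trFst _), ← trace_one_kronecker_mul, h2 (Wᴴ * trFst M * W)]
  calc _ = ((V ⊗ₖ W) * (1 ⊗ₖ single l l 1) * (V ⊗ₖ W)ᴴ * M).trace := by
        rw [← Matrix.mul_assoc, trace_mul_comm]; simp only [Matrix.mul_assoc]
    _ = ((1 ⊗ₖ (W * single l l 1 * Wᴴ)) * M).trace := by
        rw [conjTranspose_kronecker, ← mul_kronecker_mul, ← mul_kronecker_mul, Matrix.mul_one, hV]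
    _ = _ := by
        rw [trace_one_kronecker_mul, Matrix.mul_assoc, Matrix.mul_assoc, trace_mul_comm]
        simp only [Matrix.mul_assoc]

variable {V : Matrix α α ℂ} {W : Matrix β β ℂ} {a : α → ℝ} {b : β → ℝ} {A : Matrix α α ℂ}
  {B : Matrix β β ℂ}

theorem conj_kronecker_apply_eq_zero (hA : IsSpectral V a A) (hB : IsSpectral W b B)
    {M : Matrix (α × β) (α × β) ℂ} (hM : M.PosSemidef) (h1 : SuppLE (trSnd M) A)
    (h2 : SuppLE (trFst M) B) {k : α} {l : β} (h : a k * b l = 0) :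
    (((V ⊗ₖ W)ᴴ * M * (V ⊗ₖ W)) (k, l) (k, l)).re = 0 := by
  have h0 (k : α) (l : β) : 0 ≤ (((V ⊗ₖ W)ᴴ * M * (V ⊗ₖ W)) (k, l) (k, l)).re :=
    (Complex.le_def.1 (hM.conjTranspose_mul_mul_same (V ⊗ₖ W)).diag_nonneg).1
  rcases mul_eq_zero.1 h with h | h
  · have h3 := congrArg Complex.re (sum_conj_kronecker_snd V hB.mul_star M k)
    rw [hA.conj_apply_eq_zero h1 h, Complex.re_sum] at h3
    exact (Finset.sum_eq_zero_iff_of_nonneg fun l _ => h0 k l).1 h3 l (Finset.mem_univ l)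
  · have h3 := congrArg Complex.re (sum_conj_kronecker_fst hA.mul_star W M l)
    rw [hB.conj_apply_eq_zero h2 h, Complex.re_sum] at h3
    exact (Finset.sum_eq_zero_iff_of_nonneg fun k _ => h0 k l).1 h3 k (Finset.mem_univ k)

theorem suppLE_kronecker (hA : A.IsHermitian) (hB : B.IsHermitian)
    {M : Matrix (α × β) (α × β) ℂ} (hM : M.PosSemidef) (h1 : SuppLE (trSnd M) A)
    (h2 : SuppLE (trFst M) B) : SuppLE M (A ⊗ₖ B) := by
  obtain ⟨V, a, hV⟩ := exists_isSpectral hA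
  obtain ⟨W, b, hW⟩ := exists_isSpectral hB
  refine (hV.kronecker hW).suppLE fun k hk => mulVec_eq_zero_of_re hM ?_
  rw [← conj_kronecker_apply_eq_zero hV hW hM h1 h2 hk]
  congr 1
  rw [Matrix.mul_assoc]
  rfl

/-- Additivity of the logarithm on products, on the relevant support. -/
theorem logTrace_kronecker (hA : A.IsHermitian) (hB : B.IsHermitian)
    {M : Matrix (α × β) (α × β) ℂ} (hM : M.PosSemidef) (h1 : SuppLE (trSnd M) A)
    (h2 : SuppLE (trFst M) B) :
    logTrace M (A ⊗ₖ B) = logTrace (trSnd M) A + logTrace (trFst M) B := by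
  obtain ⟨V, a, hV⟩ := exists_isSpectral hA
  obtain ⟨W, b, hW⟩ := exists_isSpectral hB
  rw [(hV.kronecker hW).logTrace, hV.logTrace, hW.logTrace]
  simp only [← sum_conj_kronecker_snd V hW.mul_star, ← sum_conj_kronecker_fst hV.mul_star W,
    Complex.re_sum, Finset.mul_sum]
  rw [Fintype.sum_prod_type]
  rw [Finset.sum_comm (s := (Finset.univ : Finset β)), ← Finset.sum_add_distrib]
  refine Finset.sum_congr rfl fun k _ => ?_
  rw [← Finset.sum_add_distrib]
  refine Finset.sum_congr rfl fun l _ => ?_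
  by_cases h : a k * b l = 0
  · rw [conj_kronecker_apply_eq_zero hV hW hM h1 h2 h]; simp
  · rw [Real.logb_mul (left_ne_zero_of_mul h) (right_ne_zero_of_mul h)]; ring

end Product

/-! ### Ensembles -/

section Ensembles

variable {ι ξ : Type*} [Fintype ι] [DecidableEq ι] [Fintype ξ] [DecidableEq ξ]

theorem relEntropy_blocks_smul (p : ξ → ℝ) {ρ σ : ξ → Matrix ι ι ℂ}
    (hρ : ∀ x, (ρ x).PosSemidef) (hσ : ∀ x, (σ x).PosSemidef) (hp : ∀ x, 0 ≤ p x)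
    (hs : ∀ x, p x ≠ 0 → SuppLE (ρ x) (σ x)) :
    relEntropy (blocks fun x => (p x : ℂ) • ρ x) (blocks fun x => (p x : ℂ) • σ x) =
      ∑ x, p x * relEntropy (ρ x) (σ x) := by
  rw [relEntropy_blocks (fun x => (posSemidef_ofReal_smul (hρ x) (hp x)).isHermitian)
    (fun x => (posSemidef_ofReal_smul (hσ x) (hp x)).isHermitian)]
  refine Finset.sum_congr rfl fun x _ => ?_
  by_cases hx : p x = 0
  · simp [hx, relEntropy]
  · exact relEntropy_smul_smul _ (hρ x).isHermitian (hσ x).isHermitian (hs x hx)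

omit [Fintype ι] [DecidableEq ι] in
theorem trFst_blocks (M : ξ → Matrix ι ι ℂ) : trFst (blocks M) = ∑ x, M x := by
  ext i j; simp [trFst, blocks_apply, Matrix.sum_apply]

omit [DecidableEq ι] [Fintype ξ] in
theorem trSnd_blocks (M : ξ → Matrix ι ι ℂ) :
    trSnd (blocks M) = diagonal fun x => (M x).trace := by
  ext x y
  by_cases h : x = y <;> simp [trSnd, blocks_apply, trace, h]

/-- Joint convexity of the relative entropy, from data processing under the partial trace over the
register that holds the label. -/
theorem relEntropy_sum_le {p : ξ → ℝ} {ρ σ : ξ → Matrix ι ι ℂ}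
    (hρ : ∀ x, (ρ x).PosSemidef) (hσ : ∀ x, (σ x).PosSemidef) (hp : ∀ x, 0 ≤ p x)
    (hs : ∀ x, p x ≠ 0 → SuppLE (ρ x) (σ x)) :
    relEntropy (∑ x, (p x : ℂ) • ρ x) (∑ x, (p x : ℂ) • σ x) ≤
      ∑ x, p x * relEntropy (ρ x) (σ x) := by
  rw [← relEntropy_blocks_smul p hρ hσ hp hs, ← trFst_blocks, ← trFst_blocks]
  refine (twoPositive_trFstLinear (α := ξ) (β := ι)).relEntropy_le trace_trFst
    (blocks_posSemidef fun x => posSemidef_ofReal_smul (hρ x) (hp x))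
    (blocks_posSemidef fun x => posSemidef_ofReal_smul (hσ x) (hp x))
    (blocks_suppLE fun x => SuppLE.smul (hs x)) ?_
  change SuppLE (trFst _) (trFst _)
  rw [trFst_blocks, trFst_blocks]
  intro v hv
  rw [Matrix.sum_mulVec]
  exact Finset.sum_eq_zero fun x _ => SuppLE.smul (hs x) v
    (suppLE_sum (fun x => posSemidef_ofReal_smul (hσ x) (hp x)) x v hv)

omit [Fintype ι] [DecidableEq ι] in
theorem cqState_eq_blocks {n : ℕ} (p : Fin n → ℝ) (ω : Fin n → Matrix ι ι ℂ) :
    cqState p ω = blocks fun x => (p x : ℂ) • ω x := by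
  ext ⟨x, i⟩ ⟨y, j⟩
  simp only [cqState, Matrix.sum_apply, Matrix.smul_apply, kroneckerMap_apply, single_apply,
    blocks_apply]
  rw [Finset.sum_eq_single x (fun z _ hz => by simp [hz]) (by simp)]
  by_cases h : x = y <;> simp [h]

omit [Fintype ι] [DecidableEq ι] [Fintype ξ] in
theorem diagonal_kronecker_eq_blocks (p : ξ → ℂ) (A : Matrix ι ι ℂ) :
    diagonal p ⊗ₖ A = blocks fun x => p x • A := by
  ext ⟨x, i⟩ ⟨y, j⟩
  by_cases h : x = y <;> simp [blocks_apply, h]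

theorem mutualInfo_cqState {n : ℕ} {p : Fin n → ℝ} (hp : p ∈ stdSimplex ℝ (Fin n))
    {ω : Fin n → Matrix ι ι ℂ} (hω : ∀ x, IsState (ω x)) :
    mutualInfo (cqState p ω) = ∑ x, p x * logTrace (ω x) (ω x) -
      logTrace (∑ x, (p x : ℂ) • ω x) (∑ x, (p x : ℂ) • ω x) := by
  have h0 : (∑ x, (p x : ℂ) • ω x).PosSemidef := sum_smul_posSemidef hp.1 fun x => (hω x).1
  rw [mutualInfo, cqState_eq_blocks, trSnd_blocks, trFst_blocks, diagonal_kronecker_eq_blocks]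
  simp only [trace_smul, (hω _).2, smul_eq_mul, mul_one]
  rw [relEntropy_blocks_smul p (fun x => (hω x).1) (fun _ => h0) hp.1
    fun x hx => suppLE_sum_smul hp.1 (fun x => (hω x).1) hx, logTrace_sum_smul]
  simp only [relEntropy_eq, mul_sub, Finset.sum_sub_distrib]

/-- The equivalence behind `regroup`. -/
def regroupEquiv (ξ β ε : Type*) : (ξ × ε) × β ≃ ξ × (β × ε) where
  toFun i := (i.1.1, (i.2, i.1.2))
  invFun i := ((i.1, i.2.2), i.2.1)
  left_inv _ := rfl
  right_inv _ := rfl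

variable {β ε : Type*} [Fintype β] [Fintype ε] [DecidableEq β] [DecidableEq ε]

/-- If the reduced state on `E` does not depend on `x`, then `I(XE:B)` is the average relative
entropy to the product of the reduced states on `B` and `E`. -/
theorem mutualInfo_regroup_cqState {n : ℕ} {p : Fin n → ℝ} (hp : p ∈ stdSimplex ℝ (Fin n))
    {ω : Fin n → Matrix (β × ε) (β × ε) ℂ} (hω : ∀ x, IsState (ω x)) {τ : Matrix ε ε ℂ}
    (hτ : ∀ x, trFst (ω x) = τ) :
    mutualInfo (regroup (cqState p ω)) =
      ∑ x, p x * relEntropy (ω x) (trSnd (∑ x, (p x : ℂ) • ω x) ⊗ₖ τ) := by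
  have h0 : (∑ x, (p x : ℂ) • ω x).PosSemidef := sum_smul_posSemidef hp.1 fun x => (hω x).1
  have hη := trSnd_posSemidef h0
  have hτ0 : τ.PosSemidef := by
    -- The alphabet is nonempty, as `p` sums to `1`.
    obtain ⟨x, -⟩ : ∃ x, p x ≠ 0 := by
      by_contra! h
      have := hp.2
      simp [h] at this
    rw [← hτ x]; exact trFst_posSemidef (hω x).1
  have hs (x) (hx : p x ≠ 0) : SuppLE (ω x) (trSnd (∑ x, (p x : ℂ) • ω x) ⊗ₖ τ) := by
    refine suppLE_kronecker hη.isHermitian hτ0.isHermitian (hω x).1 ?_ ?_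
    · rw [trSnd_sum_smul]
      exact suppLE_sum_smul hp.1 (fun x => trSnd_posSemidef (hω x).1) hx
    · rw [hτ]; exact SuppLE.refl _
  have h1 : regroup (cqState p ω) = (blocks fun x => (p x : ℂ) • ω x).submatrix
      (regroupEquiv (Fin n) β ε) (regroupEquiv (Fin n) β ε) := by
    rw [cqState_eq_blocks]; rfl
  have h2 : trSnd (regroup (cqState p ω)) ⊗ₖ trFst (regroup (cqState p ω)) =
      (blocks fun x => (p x : ℂ) • (trSnd (∑ x, (p x : ℂ) • ω x) ⊗ₖ τ)).submatrix
      (regroupEquiv (Fin n) β ε) (regroupEquiv (Fin n) β ε) := by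
    have h3 : trSnd (regroup (cqState p ω)) = blocks fun x => (p x : ℂ) • τ := by
      ext ⟨x, e⟩ ⟨y, e'⟩
      rw [h1]
      by_cases h : x = y
      · subst h
        rw [← hτ x]
        simp [trSnd, trFst, blocks_apply, regroupEquiv, Finset.mul_sum]
      · simp [trSnd, blocks_apply, regroupEquiv, h]
    have h4 : trFst (regroup (cqState p ω)) = trSnd (∑ x, (p x : ℂ) • ω x) := by
      rw [← trFst_blocks, h1]
      ext b b'
      simp only [trFst, trSnd, of_apply, submatrix_apply, regroupEquiv, Equiv.coe_fn_mk,
        Fintype.sum_prod_type]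
      exact Finset.sum_comm
    rw [h3, h4]
    ext ⟨⟨x, e⟩, b⟩ ⟨⟨y, e'⟩, b'⟩
    by_cases h : x = y <;> simp [blocks_apply, regroupEquiv, h]
    ring
  rw [mutualInfo, h2, h1, relEntropy_submatrix,
    relEntropy_blocks_smul p (fun x => (hω x).1) (fun _ => hη.kronecker hτ0) hp.1 hs]
  · exact blocks_isHermitian fun x => (posSemidef_ofReal_smul (hω x).1 (hp.1 x)).isHermitian
  · exact blocks_isHermitian fun x =>
      (posSemidef_ofReal_smul (hη.kronecker hτ0) (hp.1 x)).isHermitian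

/-! ### Bounds on entropies -/

theorem logTrace_self_nonpos {ρ : Matrix ι ι ℂ} (h : IsState ρ) : logTrace ρ ρ ≤ 0 := by
  obtain ⟨U, p, hU⟩ := exists_isSpectral h.1.isHermitian
  have hp := hU.eigenvalue_nonneg h.1
  have hs : ∑ i, p i = 1 := by rw [hU.sum_eigenvalues, h.2, Complex.one_re]
  rw [hU.logTrace_self]
  refine Finset.sum_nonpos fun i _ => mul_nonpos_of_nonneg_of_nonpos (hp i) ?_
  refine Real.logb_nonpos one_lt_two (hp i) ?_
  rw [← hs]
  exact Finset.single_le_sum (fun i _ => hp i) (Finset.mem_univ i)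

theorem neg_logTrace_self_le {ρ : Matrix ι ι ℂ} (h : ρ.PosSemidef) :
    -logTrace ρ ρ ≤ Fintype.card ι / Real.log 2 := by
  obtain ⟨U, p, hU⟩ := exists_isSpectral h.isHermitian
  have hp := hU.eigenvalue_nonneg h
  rw [hU.logTrace_self, ← Finset.sum_neg_distrib]
  refine (Finset.sum_le_card_nsmul _ _ (1 / Real.log 2) fun i _ => ?_).trans_eq ?_
  · rw [Real.logb, ← mul_div_assoc, ← neg_div]
    refine div_le_div_of_nonneg_right ?_ (Real.log_pos one_lt_two).le
    rcases (hp i).eq_or_lt with h0 | h0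
    · simp [← h0]
    · have h1 := mul_le_mul_of_nonneg_left (Real.one_sub_inv_le_log_of_pos h0) h0.le
      rw [mul_sub, mul_inv_cancel₀ h0.ne'] at h1
      linarith
  · rw [nsmul_eq_mul, Finset.card_univ, mul_one_div]

theorem mutualInfo_cqState_le {n : ℕ} {p : Fin n → ℝ} (hp : p ∈ stdSimplex ℝ (Fin n))
    {ω : Fin n → Matrix ι ι ℂ} (hω : ∀ x, IsState (ω x)) :
    mutualInfo (cqState p ω) ≤ Fintype.card ι / Real.log 2 := by
  rw [mutualInfo_cqState hp hω]
  have h1 := neg_logTrace_self_le (sum_smul_posSemidef hp.1 fun x => (hω x).1)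
  have h2 : ∑ x, p x * logTrace (ω x) (ω x) ≤ 0 := Finset.sum_nonpos fun x _ =>
    mul_nonpos_of_nonneg_of_nonpos (hp.1 x) (logTrace_self_nonpos (hω x))
  linarith

end Ensembles

/-! ### Measurement in an orthonormal basis -/

section Measurement

variable {α β : Type*} [Fintype α] [Fintype β] [DecidableEq α] [DecidableEq β]

/-- The unitary matrix whose columns are the vectors of an orthonormal basis. -/
noncomputable def basisMatrix (φ : OrthonormalBasis β ℂ (EuclideanSpace ℂ β)) : Matrix β β ℂ :=
  of fun b y => φ y b

theorem basisMatrix_star_mul (φ : OrthonormalBasis β ℂ (EuclideanSpace ℂ β)) :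
    (basisMatrix φ)ᴴ * basisMatrix φ = 1 := by
  ext y y'
  have := orthonormal_iff_ite.1 φ.orthonormal y y'
  rw [PiLp.inner_apply] at this
  simpa [mul_apply, basisMatrix, one_apply, mul_comm] using this

theorem basisMatrix_mul_star (φ : OrthonormalBasis β ℂ (EuclideanSpace ℂ β)) :
    basisMatrix φ * (basisMatrix φ)ᴴ = 1 :=
  mul_eq_one_comm.1 (basisMatrix_star_mul φ)

/-- The unitary matrix that expresses operators on `A ⊗ B` in the basis `φ` of `B`, with the index
of that basis in front: measured operators become block-diagonal. -/
noncomputable def basisChange (α : Type*) [DecidableEq α]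
    (φ : OrthonormalBasis β ℂ (EuclideanSpace ℂ β)) : Matrix (α × β) (β × α) ℂ :=
  ((1 : Matrix α α ℂ) ⊗ₖ basisMatrix φ).submatrix id (Equiv.prodComm β α)

theorem basisChange_star_mul (φ : OrthonormalBasis β ℂ (EuclideanSpace ℂ β)) :
    (basisChange α φ)ᴴ * basisChange α φ = 1 := by
  rw [basisChange, conjTranspose_submatrix, ← submatrix_mul _ _ _ _ _ Function.bijective_id,
    conjTranspose_kronecker, ← mul_kronecker_mul, basisMatrix_star_mul, conjTranspose_one,
    Matrix.mul_one, one_kronecker_one]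
  exact submatrix_one_equiv (Equiv.prodComm β α)

theorem basisChange_mul_star (φ : OrthonormalBasis β ℂ (EuclideanSpace ℂ β)) :
    basisChange α φ * (basisChange α φ)ᴴ = 1 := by
  rw [basisChange, conjTranspose_submatrix, submatrix_mul_equiv,
    conjTranspose_kronecker, ← mul_kronecker_mul, basisMatrix_mul_star]
  simp

omit [DecidableEq β] in
theorem conj_basisChange_submatrix (φ : OrthonormalBasis β ℂ (EuclideanSpace ℂ β))
    (M : Matrix (α × β) (α × β) ℂ) (y : β) :
    ((basisChange α φ)ᴴ * M * basisChange α φ).submatrix (y, ·) (y, ·) = condOp M (φ y) := by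
  ext a a'
  rw [submatrix_apply, mul_apply, Fintype.sum_prod_type,
    Finset.sum_eq_single a' (fun x _ hx => by simp [basisChange, one_apply, hx]) (by simp),
    condOp, of_apply, Finset.sum_comm]
  refine Finset.sum_congr rfl fun b' _ => ?_
  rw [mul_apply, Fintype.sum_prod_type,
    Finset.sum_eq_single a (fun x _ hx => by simp [basisChange, one_apply, hx]) (by simp),
    Finset.sum_mul]
  exact Finset.sum_congr rfl fun b _ => by simp [basisChange, basisMatrix]

theorem measured_eq (φ : OrthonormalBasis β ℂ (EuclideanSpace ℂ β))
    (M : Matrix (α × β) (α × β) ℂ) :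
    measured M φ = basisChange α φ * blocks (fun y => condOp M (φ y)) * (basisChange α φ)ᴴ := by
  ext ⟨a, b⟩ ⟨a', b'⟩
  rw [measured, Matrix.sum_apply, mul_apply, Fintype.sum_prod_type]
  refine Finset.sum_congr rfl fun y _ => ?_
  rw [Finset.sum_eq_single a' (fun x _ hx => by simp [basisChange, one_apply, hx.symm]) (by simp),
    mul_apply, Fintype.sum_prod_type,
    Finset.sum_eq_single y (fun z _ hz => by simp [blocks_apply, hz]) (by simp),
    Finset.sum_eq_single a (fun x _ hx => by simp [basisChange, one_apply, hx.symm]) (by simp)]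
  simp only [basisChange, basisMatrix, proj, blocks_apply, submatrix_apply, conjTranspose_apply,
    kroneckerMap_apply, one_apply, of_apply, Equiv.prodComm_apply, Prod.swap_prod_mk, id, if_true,
    one_mul]
  ring

omit [DecidableEq β] in
theorem condOp_posSemidef {M : Matrix (α × β) (α × β) ℂ} (hM : M.PosSemidef)
    (φ : OrthonormalBasis β ℂ (EuclideanSpace ℂ β)) (y : β) : (condOp M (φ y)).PosSemidef := by
  rw [← conj_basisChange_submatrix]
  exact (hM.conjTranspose_mul_mul_same _).submatrix _

theorem measured_posSemidef {M : Matrix (α × β) (α × β) ℂ} (hM : M.PosSemidef)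
    (φ : OrthonormalBasis β ℂ (EuclideanSpace ℂ β)) : (measured M φ).PosSemidef := by
  rw [measured_eq]
  exact (blocks_posSemidef fun y => condOp_posSemidef hM φ y).mul_mul_conjTranspose_same _

omit [Fintype α] [DecidableEq α] in
theorem sum_condOp (M : Matrix (α × β) (α × β) ℂ)
    (φ : OrthonormalBasis β ℂ (EuclideanSpace ℂ β)) : ∑ y, condOp M (φ y) = trSnd M := by
  have h (b b' : β) : ∑ y, star (φ y b) * φ y b' = if b' = b then 1 else 0 := by
    have := congrFun (congrFun (basisMatrix_mul_star φ) b') b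
    simpa [mul_apply, basisMatrix, one_apply, mul_comm] using this
  ext a a'
  simp only [Matrix.sum_apply, condOp, of_apply, trSnd]
  rw [Finset.sum_comm]
  refine Finset.sum_congr rfl fun b _ => ?_
  rw [Finset.sum_comm]
  have h2 (b' : β) : ∑ y, star (φ y b) * M (a, b) (a', b') * φ y b' =
      M (a, b) (a', b') * if b' = b then 1 else 0 := by
    rw [← h, Finset.mul_sum]
    exact Finset.sum_congr rfl fun y _ => by ring
  simp only [h2]
  simp

theorem trace_measured (M : Matrix (α × β) (α × β) ℂ)
    (φ : OrthonormalBasis β ℂ (EuclideanSpace ℂ β)) : (measured M φ).trace = M.trace := by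
  rw [measured_eq, trace_mul_comm, ← Matrix.mul_assoc, basisChange_star_mul, Matrix.one_mul,
    ← trace_trSnd M, ← sum_condOp M φ, ← trFst_blocks, trace_trFst]

/-- A positive semidefinite matrix is supported in its block-diagonal part. -/
theorem suppLE_blocks_diag {ξ ι : Type*} [Fintype ξ] [DecidableEq ξ] [Fintype ι]
    {M : Matrix (ξ × ι) (ξ × ι) ℂ} (hM : M.PosSemidef) :
    SuppLE M (blocks fun x => M.submatrix (x, ·) (x, ·)) := by
  intro v hv
  -- The component of `v` in each block is a null vector of the quadratic form of `M`.
  let w (x : ξ) : ξ × ι → ℂ := fun i => if i.1 = x then v i else 0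
  have hw : v = ∑ x, w x := by
    ext i; simp [w]
  have h1 (x : ξ) : M *ᵥ w x = 0 := by
    apply mulVec_eq_zero_of_re hM
    have h2 : star (w x) ⬝ᵥ (M *ᵥ w x) =
        star (w x) ⬝ᵥ ((blocks fun x => M.submatrix (x, ·) (x, ·)) *ᵥ v) := by
      rw [dotProduct, dotProduct]
      refine Finset.sum_congr rfl fun i _ => ?_
      by_cases hi : i.1 = x
      · congr 1
        simp only [mulVec, dotProduct, blocks_apply]
        refine Finset.sum_congr rfl fun j _ => ?_
        by_cases hj : j.1 = x
        · subst hj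
          rcases i with ⟨i1, i2⟩
          rcases j with ⟨j1, j2⟩
          simp only at hi
          subst hi
          simp [w]
        · have : ¬ i.1 = j.1 := fun h => hj (h.symm.trans hi)
          simp [w, hj, this]
      · simp [w, hi]
    rw [h2, hv, dotProduct_zero, Complex.zero_re]
  rw [hw, mulVec_sum]
  exact Finset.sum_eq_zero fun x _ => h1 x

theorem suppLE_measured {M : Matrix (α × β) (α × β) ℂ} (hM : M.PosSemidef)
    (φ : OrthonormalBasis β ℂ (EuclideanSpace ℂ β)) : SuppLE M (measured M φ) := by
  intro v hv
  have h1 := basisChange_star_mul (α := α) φ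
  have h2 := basisChange_mul_star (α := α) φ
  have h3 := suppLE_blocks_diag (hM.conjTranspose_mul_mul_same (basisChange α φ))
  simp only [conj_basisChange_submatrix] at h3
  rw [measured_eq] at hv
  generalize basisChange α φ = W at *
  have h4 := h3 (Wᴴ *ᵥ v) (by
    have := congrArg (fun u => Wᴴ *ᵥ u) hv
    simp only [mulVec_mulVec, mulVec_zero] at this
    rwa [← Matrix.mul_assoc, ← Matrix.mul_assoc, h1, Matrix.one_mul, ← mulVec_mulVec] at this)
  have h5 := congrArg (fun u => W *ᵥ u) h4
  simp only [mulVec_mulVec, mulVec_zero] at h5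
  have h6 : W * (Wᴴ * M * W * Wᴴ) = M := by
    calc _ = (W * Wᴴ) * M * (W * Wᴴ) := by simp only [Matrix.mul_assoc]
      _ = M := by rw [h2, Matrix.one_mul, Matrix.mul_one]
  rwa [h6] at h5

/-- The cross entropy between a state and the measured state is the entropy of the latter. -/
theorem logTrace_measured {M : Matrix (α × β) (α × β) ℂ} (hM : M.PosSemidef)
    (φ : OrthonormalBasis β ℂ (EuclideanSpace ℂ β)) :
    logTrace M (measured M φ) = ∑ y, logTrace (condOp M (φ y)) (condOp M (φ y)) := by
  rw [measured_eq, logTrace_conj (basisChange_star_mul φ) (basisChange_mul_star φ) _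
    (blocks_isHermitian fun y => (condOp_posSemidef hM φ y).isHermitian),
    logTrace_blocks_right _ fun y => (condOp_posSemidef hM φ y).isHermitian]
  simp only [conj_basisChange_submatrix]

theorem relEntropy_measured_nonneg {M : Matrix (α × β) (α × β) ℂ} (hM : M.PosSemidef)
    (φ : OrthonormalBasis β ℂ (EuclideanSpace ℂ β)) : 0 ≤ relEntropy M (measured M φ) :=
  relEntropy_nonneg hM (measured_posSemidef hM φ) (suppLE_measured hM φ) (trace_measured M φ)

/-- Measuring `B` increases the entropy of the reduced state on `B`. -/
theorem sum_outcome_logb_le {M : Matrix (α × β) (α × β) ℂ} (hM : M.PosSemidef)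
    (φ : OrthonormalBasis β ℂ (EuclideanSpace ℂ β)) {r : β → ℝ}
    (hr : ∀ y, (condOp M (φ y)).trace = r y) :
    ∑ y, r y * Real.logb 2 (r y) ≤ logTrace (trFst M) (trFst M) := by
  have hτ := trFst_posSemidef hM
  have hr0 (y : β) : 0 ≤ r y := by
    have := (condOp_posSemidef hM φ y).trace_nonneg
    rw [hr] at this
    exact_mod_cast this
  have hd (y : β) : ((basisMatrix φ)ᴴ * trFst M * basisMatrix φ) y y = r y := by
    rw [← hr, ← sum_conj_kronecker_fst (V := (1 : Matrix α α ℂ)) (by simp), trace,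
      ← conj_basisChange_submatrix]
    rfl
  let σ := basisMatrix φ * diagonal (fun y => (r y : ℂ)) * (basisMatrix φ)ᴴ
  have hσ : IsSpectral (basisMatrix φ) r σ :=
    ⟨basisMatrix_star_mul φ, basisMatrix_mul_star φ, rfl⟩
  have h := relEntropy_nonneg hτ (hσ.posSemidef hr0) (hσ.suppLE fun y hy => ?_) ?_
  · rw [relEntropy_eq, hσ.logTrace] at h
    simp only [hd, Complex.ofReal_re, mul_comm (Real.logb 2 _)] at h
    linarith
  · apply mulVec_eq_zero_of_re hτ
    have h2 := hd y
    rw [hy, Matrix.mul_assoc] at h2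
    exact congrArg Complex.re h2
  · rw [trace_mul_comm, ← Matrix.mul_assoc, hσ.star_mul, Matrix.one_mul, trace_diagonal,
      trace_trFst, ← trace_trSnd, ← sum_condOp M φ, trace_sum]
    simp only [hr]

end Measurement

/-! ### Channels -/

section Channels

variable {α β γ r : Type*} [Fintype α] [Fintype β] [Fintype γ] [Fintype r]

/-- The map `Φ ⊗ id_R` as a linear map. -/
def applyFstLinear (r : Type*) (Φ : Matrix α α ℂ →ₗ[ℂ] Matrix β β ℂ) :
    Matrix (α × r) (α × r) ℂ →ₗ[ℂ] Matrix (β × r) (β × r) ℂ where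
  toFun := applyFst Φ
  map_add' M M' := by
    ext i j
    exact congrFun (congrFun (map_add Φ (of fun a a' => M (a, i.2) (a', j.2))
      (of fun a a' => M' (a, i.2) (a', j.2))) i.1) j.1
  map_smul' c M := by
    ext i j
    exact congrFun (congrFun (map_smul Φ c (of fun a a' => M (a, i.2) (a', j.2))) i.1) j.1

variable {Φ : Matrix α α ℂ →ₗ[ℂ] Matrix β β ℂ}

omit [Fintype α] [Fintype β] [Fintype r] in
theorem applyFst_sum_smul {ξ : Type*} [Fintype ξ] (Φ : Matrix α α ℂ →ₗ[ℂ] Matrix β β ℂ)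
    (q : ξ → ℝ) (M : ξ → Matrix (α × r) (α × r) ℂ) :
    applyFst Φ (∑ x, (q x : ℂ) • M x) = ∑ x, (q x : ℂ) • applyFst Φ (M x) := by
  have h := map_sum (applyFstLinear r Φ) (fun x => (q x : ℂ) • M x) Finset.univ
  simp only [map_smul] at h
  exact h

theorem IsChannel.comp {Ψ : Matrix β β ℂ →ₗ[ℂ] Matrix γ γ ℂ} (hΨ : IsChannel Ψ)
    (hΦ : IsChannel Φ) : IsChannel (Ψ ∘ₗ Φ) where
  completelyPositive k M hM := hΨ.completelyPositive k _ (hΦ.completelyPositive k M hM)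
  tracePreserving M := by rw [LinearMap.comp_apply, hΨ.tracePreserving, hΦ.tracePreserving]

theorem IsChannel.applyFst_posSemidef (hΦ : IsChannel Φ) {M : Matrix (α × r) (α × r) ℂ}
    (hM : M.PosSemidef) : (applyFst Φ M).PosSemidef := by
  let e := Fintype.equivFin r
  have := (hΦ.completelyPositive _ _ (hM.submatrix
    (fun i : α × Fin (Fintype.card r) => (i.1, e.symm i.2)))).submatrix
    (fun i : β × r => (i.1, e i.2))
  convert this using 1
  ext i j
  simp [applyFst]

theorem IsChannel.twoPositive_applyFstLinear (hΦ : IsChannel Φ) :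
    TwoPositive (applyFstLinear r Φ) := by
  intro M hM
  exact (hΦ.applyFst_posSemidef (hM.submatrix
    (fun i : α × (r × Fin 2) => ((i.1, i.2.1), i.2.2)))).submatrix
    (fun i : (β × r) × Fin 2 => (i.1.1, (i.1.2, i.2)))

omit [Fintype r] in
theorem IsChannel.trFst_applyFst (hΦ : IsChannel Φ) (M : Matrix (α × r) (α × r) ℂ) :
    trFst (applyFst Φ M) = trFst M := by
  ext i j
  exact hΦ.tracePreserving (of fun a a' => M (a, i) (a', j))

omit [Fintype α] [Fintype β] in
theorem trSnd_applyFst (Φ : Matrix α α ℂ →ₗ[ℂ] Matrix β β ℂ) (M : Matrix (α × r) (α × r) ℂ) :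
    trSnd (applyFst Φ M) = Φ (trSnd M) := by
  have : trSnd M = ∑ b, of fun a a' => M (a, b) (a', b) := by
    ext a a'; simp [trSnd, Matrix.sum_apply]
  rw [this, map_sum]
  ext i j
  simp [trSnd, applyFst, Matrix.sum_apply]

theorem IsChannel.trace_applyFst (hΦ : IsChannel Φ) (M : Matrix (α × r) (α × r) ℂ) :
    (applyFst Φ M).trace = M.trace := by
  rw [← trace_trFst, hΦ.trFst_applyFst, trace_trFst]

theorem IsChannel.isState_applyFst (hΦ : IsChannel Φ) {M : Matrix (α × r) (α × r) ℂ}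
    (hM : IsState M) : IsState (applyFst Φ M) :=
  ⟨hΦ.applyFst_posSemidef hM.1, by rw [hΦ.trace_applyFst, hM.2]⟩

theorem IsChannel.isState (hΦ : IsChannel Φ) {M : Matrix α α ℂ} (hM : IsState M) :
    IsState (Φ M) := by
  refine ⟨?_, by rw [hΦ.tracePreserving, hM.2]⟩
  exact (hΦ.applyFst_posSemidef (hM.1.submatrix (fun i : α × Unit => i.1))).submatrix
    (fun i : β => (i, ()))

omit [Fintype α] [Fintype β] in
theorem condOp_applyFst (Φ : Matrix α α ℂ →ₗ[ℂ] Matrix β β ℂ) (M : Matrix (α × r) (α × r) ℂ)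
    (φ : EuclideanSpace ℂ r) : condOp (applyFst Φ M) φ = Φ (condOp M φ) := by
  have : condOp M φ = ∑ b, ∑ b', (star (φ b) * φ b') • of fun a a' => M (a, b) (a', b') := by
    ext a a'
    simp only [condOp, Matrix.sum_apply, of_apply, Matrix.smul_apply, smul_eq_mul]
    exact Finset.sum_congr rfl fun b _ => Finset.sum_congr rfl fun b' _ => by ring
  rw [this]
  simp only [map_sum, map_smul]
  ext i j
  simp only [condOp, Matrix.sum_apply, of_apply, Matrix.smul_apply, smul_eq_mul, applyFst]
  exact Finset.sum_congr rfl fun b _ => Finset.sum_congr rfl fun b' _ => by ring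

omit [Fintype α] [Fintype β] in
theorem measured_applyFst [DecidableEq r] (Φ : Matrix α α ℂ →ₗ[ℂ] Matrix β β ℂ)
    (M : Matrix (α × r) (α × r) ℂ) (φ : OrthonormalBasis r ℂ (EuclideanSpace ℂ r)) :
    measured (applyFst Φ M) φ = applyFst Φ (measured M φ) := by
  have : measured M φ = ∑ y, condOp M (φ y) ⊗ₖ proj (φ y) := rfl
  rw [this]
  have h2 : applyFst Φ (∑ y, condOp M (φ y) ⊗ₖ proj (φ y)) =
      ∑ y, applyFst Φ (condOp M (φ y) ⊗ₖ proj (φ y)) :=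
    map_sum (applyFstLinear r Φ) _ _
  rw [h2, measured]
  refine Finset.sum_congr rfl fun y _ => ?_
  rw [condOp_applyFst]
  ext i j
  have : (of fun a a' => (condOp M (φ y) ⊗ₖ proj (φ y)) (a, i.2) (a', j.2)) =
      proj (φ y) i.2 j.2 • condOp M (φ y) := by
    ext a a'; simp [mul_comm]
  rw [applyFst, of_apply, this, map_smul]
  simp [mul_comm]

theorem exists_isState (α : Type*) [Fintype α] [Nonempty α] :
    ∃ σ : Matrix α α ℂ, IsState σ := by
  classical
  obtain ⟨a⟩ := ‹Nonempty α›
  refine ⟨single a a 1, ?_, by simp⟩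
  rw [← diagonal_single]
  refine PosSemidef.diagonal fun i => ?_
  by_cases h : i = a
  · subst h; simp
  · simp [h]

/-- The channel that discards its input and prepares a given state. -/
theorem exists_isChannel (α β : Type*) [Fintype α] [Fintype β] [Nonempty β] :
    ∃ Φ : Matrix α α ℂ →ₗ[ℂ] Matrix β β ℂ, IsChannel Φ := by
  classical
  obtain ⟨σ, hσ⟩ := exists_isState β
  refine ⟨(traceLinearMap α ℂ ℂ).smulRight σ, ⟨fun k M hM => ?_, fun M => by simp [hσ.2]⟩⟩
  have : applyFst ((traceLinearMap α ℂ ℂ).smulRight σ) M = σ ⊗ₖ trFst M := by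
    ext i j
    simp [applyFst, trFst, trace, mul_comm]
  rw [this]
  exact hσ.1.kronecker (trFst_posSemidef hM)

/-- A positive semidefinite matrix is a multiple of a state, even if it vanishes. -/
theorem exists_eq_smul_isState [Nonempty α] {A : Matrix α α ℂ} (hA : A.PosSemidef) :
    ∃ σ, IsState σ ∧ A = ((A.trace.re : ℝ) : ℂ) • σ := by
  classical
  have h0 := Complex.le_def.1 hA.trace_nonneg
  have h1 : A.trace = ((A.trace.re : ℝ) : ℂ) := Complex.ext rfl h0.2.symm
  by_cases h : A.trace.re = 0
  · obtain ⟨σ, hσ⟩ := exists_isState α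
    have : A = 0 := hA.trace_eq_zero_iff.1 (by rw [h1, h]; simp)
    exact ⟨σ, hσ, by simp [this]⟩
  · have h2 : ((A.trace.re : ℝ) : ℂ) ≠ 0 := by exact_mod_cast h
    refine ⟨((A.trace.re⁻¹ : ℝ) : ℂ) • A, ⟨posSemidef_ofReal_smul hA (inv_nonneg.2 h0.1), ?_⟩, ?_⟩
    · rw [trace_smul, smul_eq_mul, Complex.ofReal_inv]
      conv_lhs => rw [h1]
      simp [h2]
    · rw [smul_smul, Complex.ofReal_inv, mul_inv_cancel₀ h2, one_smul]

end Channels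

/-! ### Holevo information and assisted information -/

section Informations

variable {α β εA εB : Type*} [Fintype α] [Fintype β] [Fintype εA] [Fintype εB]
  [DecidableEq β] [DecidableEq εB]

theorem logTrace_smul_self (c : ℝ) {ρ : Matrix β β ℂ} (hρ : IsState ρ) :
    logTrace ((c : ℂ) • ρ) ((c : ℂ) • ρ) = c * Real.logb 2 c + c * logTrace ρ ρ := by
  by_cases hc : c = 0
  · simp [hc, logTrace]
  · rw [logTrace_smul_left, logTrace_smul_right hc hρ.1.isHermitian (SuppLE.refl _), hρ.2,
      Complex.one_re]
    ring

theorem bddAbove_holevoValues {N : Matrix α α ℂ →ₗ[ℂ] Matrix β β ℂ} (hN : IsChannel N) :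
    BddAbove (holevoValues N) := by
  refine ⟨Fintype.card β / Real.log 2, ?_⟩
  rintro v ⟨n, p, σ, hp, hσ, rfl⟩
  exact mutualInfo_cqState_le hp fun x => hN.isState (hσ x)

theorem bddAbove_assistedHolevoValues {ρ : Matrix (εA × εB) (εA × εB) ℂ} (hρ : IsState ρ)
    {N : Matrix α α ℂ →ₗ[ℂ] Matrix β β ℂ} (hN : IsChannel N) :
    BddAbove (assistedHolevoValues ρ N) := by
  refine ⟨Fintype.card (β × εB) / Real.log 2, ?_⟩
  rintro v ⟨n, p, E, hp, hE, rfl⟩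
  exact mutualInfo_cqState_le hp fun x => (hN.comp (hE x)).isState_applyFst hρ

theorem stdSimplex_fin_one : (fun _ => 1 : Fin 1 → ℝ) ∈ stdSimplex ℝ (Fin 1) :=
  ⟨fun _ => zero_le_one, by simp⟩

theorem holevoValues_nonempty [Nonempty α] (N : Matrix α α ℂ →ₗ[ℂ] Matrix β β ℂ) :
    (holevoValues N).Nonempty := by
  obtain ⟨σ, hσ⟩ := exists_isState α
  exact ⟨_, 1, _, fun _ => σ, stdSimplex_fin_one, fun _ => hσ, rfl⟩

theorem assistedHolevoValues_nonempty [Nonempty α] (ρ : Matrix (εA × εB) (εA × εB) ℂ)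
    (N : Matrix α α ℂ →ₗ[ℂ] Matrix β β ℂ) : (assistedHolevoValues ρ N).Nonempty := by
  obtain ⟨E, hE⟩ := exists_isChannel εA α
  exact ⟨_, 1, _, fun _ => E, stdSimplex_fin_one, fun _ => hE, rfl⟩

theorem assistedMutualValues_nonempty [Nonempty α] (ρ : Matrix (εA × εB) (εA × εB) ℂ)
    (N : Matrix α α ℂ →ₗ[ℂ] Matrix β β ℂ) : (assistedMutualValues ρ N).Nonempty := by
  obtain ⟨E, hE⟩ := exists_isChannel εA α
  exact ⟨_, 1, _, fun _ => E, stdSimplex_fin_one, fun _ => hE, rfl⟩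

/-- The Holevo information of an ensemble with an arbitrary finite alphabet is at most `χ(N)`. -/
theorem holevo_ensemble_le {N : Matrix α α ℂ →ₗ[ℂ] Matrix β β ℂ} (hN : IsChannel N)
    {ξ : Type*} [Fintype ξ] {p : ξ → ℝ} (hp : p ∈ stdSimplex ℝ ξ) {σ : ξ → Matrix α α ℂ}
    (hσ : ∀ x, IsState (σ x)) :
    ∑ x, p x * logTrace (N (σ x)) (N (σ x)) -
      logTrace (∑ x, (p x : ℂ) • N (σ x)) (∑ x, (p x : ℂ) • N (σ x)) ≤ holevoInfo N := by
  let e := (Fintype.equivFin ξ).symm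
  have hp' : (fun i => p (e i)) ∈ stdSimplex ℝ (Fin (Fintype.card ξ)) :=
    ⟨fun i => hp.1 _, by rw [e.sum_comp p]; exact hp.2⟩
  have := le_csSup (bddAbove_holevoValues hN)
    ⟨_, _, fun i => σ (e i), hp', fun i => hσ _, rfl⟩
  rw [mutualInfo_cqState hp' fun i => hN.isState (hσ _),
    e.sum_comp fun x => p x * logTrace (N (σ x)) (N (σ x)),
    e.sum_comp fun x => (p x : ℂ) • N (σ x)] at this
  exact this

/-- The first inequality, for each encoding: `I(XE_B:B) - I(X:BE_B) = I(B:E_B) ≥ 0`, because the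
reduced state on `E_B` is independent of `X`. -/
theorem mutualInfo_assistedState_le {ρ : Matrix (εA × εB) (εA × εB) ℂ} (hρ : IsState ρ)
    {N : Matrix α α ℂ →ₗ[ℂ] Matrix β β ℂ} (hN : IsChannel N) {n : ℕ} {p : Fin n → ℝ}
    (hp : p ∈ stdSimplex ℝ (Fin n)) {E : Fin n → (Matrix εA εA ℂ →ₗ[ℂ] Matrix α α ℂ)}
    (hE : ∀ x, IsChannel (E x)) :
    mutualInfo (assistedState ρ N p E) ≤ mutualInfo (regroup (assistedState ρ N p E)) := by
  have hω (x) : IsState (applyFst (N ∘ₗ E x) ρ) := (hN.comp (hE x)).isState_applyFst hρ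
  have hτ (x) : trFst (applyFst (N ∘ₗ E x) ρ) = trFst ρ := (hN.comp (hE x)).trFst_applyFst ρ
  rw [assistedState, mutualInfo_cqState hp hω, mutualInfo_regroup_cqState hp hω hτ]
  have hs := IsState.sum_smul hp hω
  have hτ' : trFst (∑ x, (p x : ℂ) • applyFst (N ∘ₗ E x) ρ) = trFst ρ := by
    rw [trFst_sum_smul]
    simp only [hτ]
    rw [← Finset.sum_smul, ← Complex.ofReal_sum, hp.2, Complex.ofReal_one, one_smul]
  simp only [relEntropy_eq, mul_sub, Finset.sum_sub_distrib]
  rw [← logTrace_sum_smul p]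
  generalize (∑ x, (p x : ℂ) • applyFst (N ∘ₗ E x) ρ) = ω at *
  have h := relEntropy_nonneg hs.1 (hs.trSnd.1.kronecker hs.trFst.1)
    (suppLE_kronecker hs.trSnd.1.isHermitian hs.trFst.1.isHermitian hs.1 (SuppLE.refl _)
      (SuppLE.refl _)) (by rw [trace_kronecker, hs.trSnd.2, hs.trFst.2, hs.2, one_mul])
  rw [relEntropy_eq, hτ'] at h
  linarith

/-- The core estimate: replacing the assisting state by its measured version changes the relative
entropy to a product by at most the relative entropy of discord of the measurement. The two
ingredients are data processing under `Φ ⊗ id` and the fact that the measurement increases the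
entropy of the reduced state on `E_B`. -/
theorem relEntropy_applyFst_le {ρ : Matrix (εA × εB) (εA × εB) ℂ} [DecidableEq εA]
    (hρ : IsState ρ) {Φ : Matrix εA εA ℂ →ₗ[ℂ] Matrix β β ℂ} (hΦ : IsChannel Φ)
    {η : Matrix β β ℂ} (hη : η.IsHermitian) (hs : SuppLE (Φ (trSnd ρ)) η)
    (φ : OrthonormalBasis εB ℂ (EuclideanSpace ℂ εB)) {r : εB → ℝ}
    {S : εB → Matrix εA εA ℂ} (hS : ∀ y, IsState (S y))
    (hr : ∀ y, condOp ρ (φ y) = (r y : ℂ) • S y) :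
    relEntropy (applyFst Φ ρ) (η ⊗ₖ trFst ρ) ≤ relEntropy ρ (measured ρ φ) +
      ∑ y, r y * logTrace (Φ (S y)) (Φ (S y)) - logTrace (Φ (trSnd ρ)) η := by
  have hω := hΦ.isState_applyFst hρ
  have hτ := hΦ.trFst_applyFst ρ
  have hc (y) : condOp (applyFst Φ ρ) (φ y) = (r y : ℂ) • Φ (S y) := by
    rw [condOp_applyFst, hr, map_smul]
  have h1 : relEntropy (applyFst Φ ρ) (measured (applyFst Φ ρ) φ) ≤
      relEntropy ρ (measured ρ φ) := by
    have h := (hΦ.twoPositive_applyFstLinear (r := εB)).relEntropy_le hΦ.trace_applyFst hρ.1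
      (measured_posSemidef hρ.1 φ) (suppLE_measured hρ.1 φ)
    simp only [applyFstLinear, LinearMap.coe_mk, AddHom.coe_mk] at h
    rw [← measured_applyFst] at h
    exact h (suppLE_measured hω.1 φ)
  have h2 := sum_outcome_logb_le hω.1 φ (r := r) fun y => by
    rw [hc, trace_smul, (hΦ.isState (hS y)).2, smul_eq_mul, mul_one]
  rw [hτ] at h2
  rw [relEntropy_eq, logTrace_measured hω.1] at h1
  simp only [hc, logTrace_smul_self _ (hΦ.isState (hS _)), Finset.sum_add_distrib] at h1
  rw [relEntropy_eq, logTrace_kronecker hη hρ.trFst.1.isHermitian hω.1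
    (by rwa [trSnd_applyFst]) (by rw [hτ]; exact SuppLE.refl _), hτ, trSnd_applyFst]
  linarith

/-- Every value of `I(XE_B:B)` exceeds `χ(N)` by at most the average over a decomposition of `ρ` of
the relative entropies to the measured states. -/
theorem mutualInfo_regroup_assistedState_le [DecidableEq εA]
    {ρ : Matrix (εA × εB) (εA × εB) ℂ} (hρ : IsState ρ)
    {N : Matrix α α ℂ →ₗ[ℂ] Matrix β β ℂ} (hN : IsChannel N) {n : ℕ} {p : Fin n → ℝ}
    (hp : p ∈ stdSimplex ℝ (Fin n)) {E : Fin n → (Matrix εA εA ℂ →ₗ[ℂ] Matrix α α ℂ)}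
    (hE : ∀ x, IsChannel (E x)) {m : ℕ} {q : Fin m → ℝ} (hq : q ∈ stdSimplex ℝ (Fin m))
    {σ : Fin m → Matrix (εA × εB) (εA × εB) ℂ} (hσ : ∀ j, IsState (σ j))
    (hρσ : ρ = ∑ j, (q j : ℂ) • σ j)
    (φ : Fin m → OrthonormalBasis εB ℂ (EuclideanSpace ℂ εB)) :
    mutualInfo (regroup (assistedState ρ N p E)) ≤
      holevoInfo N + ∑ j, q j * relEntropy (σ j) (measured (σ j) (φ j)) := by
  have hεA : Nonempty εA := by
    by_contra h
    rw [not_nonempty_iff] at h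
    have := hρ.2
    simp [trace] at this
  have hch (x) := hN.comp (hE x)
  have hω (x) : IsState (applyFst (N ∘ₗ E x) ρ) := (hch x).isState_applyFst hρ
  have hτ (x) : trFst (applyFst (N ∘ₗ E x) ρ) = trFst ρ := (hch x).trFst_applyFst ρ
  rw [assistedState, mutualInfo_regroup_cqState hp hω hτ]
  choose S hS hSeq using fun j y => exists_eq_smul_isState (condOp_posSemidef (hσ j).1 (φ j) y)
  set r : Fin m → εB → ℝ := fun j y => (condOp (σ j) (φ j y)).trace.re with hr
  have hr0 (j y) : 0 ≤ r j y :=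
    (Complex.le_def.1 (condOp_posSemidef (hσ j).1 (φ j) y).trace_nonneg).1
  have hr1 (j) : ∑ y, r j y = 1 := by
    rw [hr, ← Complex.re_sum, ← trace_sum, sum_condOp, trace_trSnd, (hσ j).2, Complex.one_re]
  -- The ensemble of inputs to `N` is indexed by the message, the term of the decomposition and the
  -- outcome of the measurement.
  have hP : (fun z : Fin n × (Fin m × εB) => p z.1 * (q z.2.1 * r z.2.1 z.2.2)) ∈
      stdSimplex ℝ (Fin n × (Fin m × εB)) := by
    refine ⟨fun z => mul_nonneg (hp.1 _) (mul_nonneg (hq.1 _) (hr0 _ _)), ?_⟩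
    simp only [Fintype.sum_prod_type, ← Finset.mul_sum, hr1, mul_one, hq.2, hp.2]
  have hχ := holevo_ensemble_le hN hP (σ := fun z => E z.1 (S z.2.1 z.2.2))
    fun z => (hE _).isState (hS _ _)
  set η := trSnd (∑ x, (p x : ℂ) • applyFst (N ∘ₗ E x) ρ) with hη
  have hη0 : IsState η := (IsState.sum_smul hp hω).trSnd
  have hmarg (x j) : (N ∘ₗ E x) (trSnd (σ j)) = ∑ y, (r j y : ℂ) • N (E x (S j y)) := by
    rw [← sum_condOp (σ j) (φ j), map_sum]
    refine Finset.sum_congr rfl fun y _ => ?_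
    conv_lhs => rw [hSeq j y]
    rw [map_smul]; rfl
  have hη1 : η = ∑ x, (p x : ℂ) • ∑ j, (q j : ℂ) • (N ∘ₗ E x) (trSnd (σ j)) := by
    rw [hη, trSnd_sum_smul]
    refine Finset.sum_congr rfl fun x _ => ?_
    rw [trSnd_applyFst, hρσ, trSnd_sum_smul, map_sum]
    simp only [map_smul]
  have hη2 : ∑ z : Fin n × (Fin m × εB), ((p z.1 * (q z.2.1 * r z.2.1 z.2.2) : ℝ) : ℂ) •
      N (E z.1 (S z.2.1 z.2.2)) = η := by
    rw [hη1]
    simp only [hmarg, Fintype.sum_prod_type, Finset.smul_sum, smul_smul, Complex.ofReal_mul]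
  rw [hη2] at hχ
  have hmargState (x j) : IsState ((N ∘ₗ E x) (trSnd (σ j))) := (hch x).isState (hσ j).trSnd
  have hsupp (x j) (hx : p x ≠ 0) (hj : q j ≠ 0) : SuppLE ((N ∘ₗ E x) (trSnd (σ j))) η := by
    rw [hη1]
    exact (suppLE_sum_smul hq.1 (fun j => (hmargState x j).1) hj).trans
      (suppLE_sum_smul hp.1 (fun x => (IsState.sum_smul hq (hmargState x)).1) hx)
  have hstep (x) : p x * relEntropy (applyFst (N ∘ₗ E x) ρ) (η ⊗ₖ trFst ρ) ≤
      p x * ∑ j, q j * (relEntropy (σ j) (measured (σ j) (φ j)) +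
        ∑ y, r j y * logTrace (N (E x (S j y))) (N (E x (S j y))) -
        logTrace ((N ∘ₗ E x) (trSnd (σ j))) η) := by
    by_cases hx : p x = 0
    · simp [hx]
    refine mul_le_mul_of_nonneg_left ?_ (hp.1 x)
    have hτρ : η ⊗ₖ trFst ρ = ∑ j, (q j : ℂ) • (η ⊗ₖ trFst (σ j)) := by
      rw [hρσ, trFst_sum_smul]
      ext i i'
      simp only [kroneckerMap_apply, Matrix.sum_apply, Matrix.smul_apply, smul_eq_mul,
        Finset.mul_sum]
      exact Finset.sum_congr rfl fun j _ => by ring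
    rw [hτρ, hρσ, applyFst_sum_smul]
    refine (relEntropy_sum_le (fun j => ((hch x).isState_applyFst (hσ j)).1)
      (fun j => hη0.1.kronecker (hσ j).trFst.1) hq.1 fun j hj => ?_).trans ?_
    · refine suppLE_kronecker hη0.1.isHermitian (hσ j).trFst.1.isHermitian
        ((hch x).isState_applyFst (hσ j)).1 ?_ ?_
      · rw [trSnd_applyFst]; exact hsupp x j hx hj
      · rw [(hch x).trFst_applyFst]; exact SuppLE.refl _
    · refine Finset.sum_le_sum fun j _ => ?_
      by_cases hj : q j = 0
      · simp [hj]
      exact mul_le_mul_of_nonneg_left (relEntropy_applyFst_le (hσ j) (hch x) hη0.1.isHermitian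
        (hsupp x j hx hj) (φ j) (hS j) (hSeq j)) (hq.1 j)
  refine (Finset.sum_le_sum fun x _ => hstep x).trans ?_
  have e1 : ∑ x, p x * ∑ j, q j * relEntropy (σ j) (measured (σ j) (φ j)) =
      ∑ j, q j * relEntropy (σ j) (measured (σ j) (φ j)) := by
    rw [← Finset.sum_mul, hp.2, one_mul]
  have e2 : ∑ x, p x * ∑ j, q j * ∑ y, r j y * logTrace (N (E x (S j y))) (N (E x (S j y))) =
      ∑ z : Fin n × (Fin m × εB), p z.1 * (q z.2.1 * r z.2.1 z.2.2) *
        logTrace (N (E z.1 (S z.2.1 z.2.2))) (N (E z.1 (S z.2.1 z.2.2))) := by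
    simp only [Fintype.sum_prod_type, Finset.mul_sum, mul_assoc]
  have e3 : ∑ x, p x * ∑ j, q j * logTrace ((N ∘ₗ E x) (trSnd (σ j))) η = logTrace η η := by
    conv_rhs => enter [1]; rw [hη1]
    rw [logTrace_sum_smul]
    simp only [logTrace_sum_smul]
  simp only [mul_add, mul_sub, Finset.sum_add_distrib, Finset.sum_sub_distrib]
  rw [e1, e2, e3]
  linarith

end Informations

/-! ### Discord -/

section Discord

variable {α β : Type*} [Fintype α] [Fintype β] [DecidableEq α] [DecidableEq β]

theorem discordValues_nonneg {σ : Matrix (α × β) (α × β) ℂ} (hσ : IsState σ) :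
    ∀ v ∈ discordValues σ, 0 ≤ v := by
  rintro v ⟨φ, rfl⟩
  exact relEntropy_measured_nonneg hσ.1 φ

theorem discordValues_nonempty (σ : Matrix (α × β) (α × β) ℂ) : (discordValues σ).Nonempty :=
  ⟨_, EuclideanSpace.basisFun β ℂ, rfl⟩

theorem isGLB_relEntropyDiscord {σ : Matrix (α × β) (α × β) ℂ} (hσ : IsState σ) :
    IsGLB (discordValues σ) (relEntropyDiscord σ) :=
  isGLB_csInf (discordValues_nonempty σ) ⟨0, discordValues_nonneg hσ⟩

theorem relEntropyDiscord_nonneg {σ : Matrix (α × β) (α × β) ℂ} (hσ : IsState σ) :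
    0 ≤ relEntropyDiscord σ :=
  (isGLB_relEntropyDiscord hσ).2 (discordValues_nonneg hσ)

theorem formationValues_nonempty {ρ : Matrix (α × β) (α × β) ℂ} (hρ : IsState ρ) :
    (formationValues ρ).Nonempty :=
  ⟨_, 1, _, fun _ => ρ, stdSimplex_fin_one, fun _ => hρ, by simp, rfl⟩

theorem isGLB_discordOfFormation {ρ : Matrix (α × β) (α × β) ℂ} (hρ : IsState ρ) :
    IsGLB (formationValues ρ) (discordOfFormation ρ) := by
  refine isGLB_csInf (formationValues_nonempty hρ) ⟨0, ?_⟩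
  rintro v ⟨n, p, σ, hp, hσ, -, rfl⟩
  exact Finset.sum_nonneg fun x _ => mul_nonneg (hp.1 x) (relEntropyDiscord_nonneg (hσ x))

/-- The measurement bases of a decomposition may be chosen nearly optimally. -/
theorem exists_basis_sum_le {m : ℕ} {q : Fin m → ℝ} (hq : q ∈ stdSimplex ℝ (Fin m))
    {σ : Fin m → Matrix (α × β) (α × β) ℂ} {δ : ℝ} (hδ : 0 < δ) :
    ∃ φ : Fin m → OrthonormalBasis β ℂ (EuclideanSpace ℂ β),
      ∑ j, q j * relEntropy (σ j) (measured (σ j) (φ j)) ≤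
        ∑ j, q j * relEntropyDiscord (σ j) + δ := by
  have h (j) : ∃ φ : OrthonormalBasis β ℂ (EuclideanSpace ℂ β),
      relEntropy (σ j) (measured (σ j) φ) < relEntropyDiscord (σ j) + δ := by
    obtain ⟨_, ⟨φ, rfl⟩, hφ⟩ := exists_lt_of_csInf_lt (discordValues_nonempty (σ j))
      (lt_add_of_pos_right (relEntropyDiscord (σ j)) hδ)
    exact ⟨φ, hφ⟩
  choose φ hφ using h
  refine ⟨φ, (Finset.sum_le_sum fun j _ =>
    mul_le_mul_of_nonneg_left (hφ j).le (hq.1 j)).trans_eq ?_⟩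
  simp only [mul_add, Finset.sum_add_distrib]
  rw [← Finset.sum_mul, hq.2, one_mul]

end Discord

end QInfo

theorem mainTheorem3 {α β εA εB : Type*}
    [Fintype α] [Fintype β] [Fintype εA] [Fintype εB]
    [DecidableEq β] [DecidableEq εA] [DecidableEq εB] [Nonempty α]
    (ρ : Matrix (εA × εB) (εA × εB) ℂ) (hρ : QInfo.IsState ρ)
    (N : Matrix α α ℂ →ₗ[ℂ] Matrix β β ℂ) (hN : QInfo.IsChannel N) :
    (IsLUB (QInfo.holevoValues N) (QInfo.holevoInfo N) ∧
      IsLUB (QInfo.assistedHolevoValues ρ N) (QInfo.assistedHolevoInfo ρ N) ∧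
      IsLUB (QInfo.assistedMutualValues ρ N) (QInfo.assistedMutualInfo ρ N) ∧
      IsGLB (QInfo.formationValues ρ) (QInfo.discordOfFormation ρ) ∧
      (∀ σ : Matrix (εA × εB) (εA × εB) ℂ, QInfo.IsState σ →
        IsGLB (QInfo.discordValues σ) (QInfo.relEntropyDiscord σ))) ∧
    QInfo.assistedHolevoInfo ρ N - QInfo.holevoInfo N ≤
      QInfo.assistedMutualInfo ρ N - QInfo.holevoInfo N ∧
    QInfo.assistedMutualInfo ρ N - QInfo.holevoInfo N ≤ QInfo.discordOfFormation ρ := by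
  have hle : ∀ w ∈ QInfo.formationValues ρ,
      QInfo.holevoInfo N + w ∈ upperBounds (QInfo.assistedMutualValues ρ N) := by
    rintro _ ⟨m, q, σ, hq, hσ, hρσ, rfl⟩ _ ⟨n, p, E, hp, hE, rfl⟩
    refine le_of_forall_pos_le_add fun δ hδ => ?_
    obtain ⟨φ, hφ⟩ := QInfo.exists_basis_sum_le hq (σ := σ) hδ
    have := QInfo.mutualInfo_regroup_assistedState_le hρ hN hp hE hq hσ hρσ φ
    linarith
  have hLUB : IsLUB (QInfo.assistedMutualValues ρ N) (QInfo.assistedMutualInfo ρ N) := by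
    obtain ⟨w, hw⟩ := QInfo.formationValues_nonempty hρ
    exact isLUB_csSup (QInfo.assistedMutualValues_nonempty ρ N) ⟨_, hle w hw⟩
  have hLUB' : IsLUB (QInfo.assistedHolevoValues ρ N) (QInfo.assistedHolevoInfo ρ N) :=
    isLUB_csSup (QInfo.assistedHolevoValues_nonempty ρ N)
      (QInfo.bddAbove_assistedHolevoValues hρ hN)
  refine ⟨⟨isLUB_csSup (QInfo.holevoValues_nonempty N) (QInfo.bddAbove_holevoValues hN), hLUB',
    hLUB, QInfo.isGLB_discordOfFormation hρ, fun σ hσ => QInfo.isGLB_relEntropyDiscord hσ⟩,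
    sub_le_sub_right (hLUB'.2 ?_) _, (QInfo.isGLB_discordOfFormation hρ).2 fun w hw => ?_⟩
  · rintro _ ⟨n, p, E, hp, hE, rfl⟩
    exact (QInfo.mutualInfo_assistedState_le hρ hN hp hE).trans (hLUB.1 ⟨n, p, E, hp, hE, rfl⟩)
  · have := hLUB.2 (hle w hw)
    linarith
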